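/- Let $1<\zeta\le 2$ and $\varphi(x)=|x|^{\zeta}/\zeta$ (class $C_{II}$). On a probability space, a random variable $\xi$ is $\varphi$-sub-Gaussian, $\xi\in \mathrm{Sub}_\varphi(\Omega)$, if for some $a\ge 0$ one has $E e^{\lambda\xi}\le e^{\varphi(a\lambda)}$ for all $\lambda\in\mathbb R$; $\tau_\varphi(\xi)$ is the infimum of such $a$. Let $T>0$, $\alpha\in(0,1)$, $C\ge 0$, and let $X=\{X(t),t\in[0,T]\}$ be a separable process with $X(t)\in\mathrm{Sub}_\varphi(\Omega)$ for all $t$ and $$\sup_{|t-s|\le h}\tau_\varphi(X(t)-X(s))\le \sigma(h)=Ch^\alpha\qquad(h>0).$$ Let $X(t)=\sum_{k=1}^\infty \xi_k a_k(t)$ in mean square for every $t\in[0,T]$, with independent $\xi_k\in\mathrm{Sub}_\varphi(\Omega)$. Let $\hat a_k$ be approximations of $a_k$, let $\delta_k=a_k-\hat a_k$, let $X_N(t)=\sum_{k=1}^N\xi_k\hat a_k(t)$ be the model and $\Delta_N=X-X_N$ its error. Assume that (C1) for all $t,s\in[0,T]$, $|\delta_k(t)-\delta_k(s)|\le\tilde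 C_k|t-s|^\alpha$ for $1\le k\le N$ and $|a_k(t)-a_k(s)|\le\hat C_k|t-s|^\alpha$ for all $k$, with non-negative constants $\tilde C_k,\hat C_k$. Then $\Delta_N(t)\in\mathrm{Sub}_\varphi(\Omega)$ for all $t\in[0,T]$, and: (i) $\sup_{|t-s|\le h}\tau_\varphi(\Delta_N(t)-\Delta_N(s))\le C_N h^\alpha$ for $h>0$ holds with $C_N=\bigl(C^\zeta+\sum_{k=1}^N\tau_\varphi^\zeta(\xi_k)\tilde C_k^{\,\zeta}\bigr)^{1/\zeta}$ (so with $C_N=C$ if $\hat a_k=a_k$ for $k\le N$). (ii) $\gamma_N:=\sup_{u\in[0,T]}\tau_\varphi(\Delta_N(u))$ is finite and $$\gamma_N^\zeta\le\sum_{k=1}^N\tau_\varphi^\zeta(\xi_k)\sup_{u\in[0,T]}|\delta_k(u)|^\zeta+\sum_{k=N+1}^\infty\tau_\varphi^\zeta(\xi_k)\sup_{u\in[0,T]}|a_k(u)|^\zeta\in[0,\infty].$$ (iii) Let $C_N\ge 0$ be any constant for which the inequality in (i) holds, $\beta=C_N(T/2)^\alpha$, and let $\gamma>0$ and $\delta$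 be real numbers with $\gamma_N\le\gamma<\delta$. If $$\nu\ \ge\ 2\exp\left\{-\frac{(\zeta-1)\,\delta^{\frac1{\zeta-1}}(\delta-\gamma)^{\frac{\zeta}{\zeta-1}}}{\zeta\,\bigl(\gamma^\zeta(\delta-\gamma)+\beta^\zeta\gamma\bigr)^{\frac1{\zeta-1}}}\right\}\,2\left(\frac{e\delta}{\gamma}\right)^{1/\alpha},$$ then $X_N$ approximates $X$ with reliability $1-\nu$ and accuracy $\delta$ in $C([0,T])$, that is, $P\{\sup_{t\in[0,T]}|\Delta_N(t)|>\delta\}\le\nu$. No further lower restriction on $\delta$ is needed. -/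

import Mathlib

open MeasureTheory ProbabilityTheory Filter Topology

namespace PhiSub

/-- The function `φ(t) = |t|^ζ / ζ` (the even extension of `t^ζ / ζ`). The class `C_II`
consists of these functions for `1 < ζ ≤ 2`. -/
noncomputable def powPhi (ζ : ℝ) (t : ℝ) : ℝ := |t| ^ ζ / ζ

variable {Ω : Type*} [MeasurableSpace Ω]

/-- `E exp(l ξ) ≤ exp(φ(a l))` for all real `l`. The expectation is a `[0, ∞]`-valued integral, so
that the inequality contains the existence of the exponential moments. -/
def ExpBound (φ : ℝ → ℝ) (P : Measure Ω) (ξ : Ω → ℝ) (a : ℝ) : Prop :=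
  ∀ l : ℝ, ∫⁻ ω, ENNReal.ofReal (Real.exp (l * ξ ω)) ∂P ≤ ENNReal.ofReal (Real.exp (φ (a * l)))

/-- `ξ` is a `φ`-sub-Gaussian random variable, `ξ ∈ Sub_φ(Ω)`. -/
def IsSub (φ : ℝ → ℝ) (P : Measure Ω) (ξ : Ω → ℝ) : Prop :=
  Measurable ξ ∧ ∃ a : ℝ, 0 ≤ a ∧ ExpBound φ P ξ a

/-- The `φ`-sub-Gaussian standard `τ_φ(ξ)`. -/
noncomputable def tau (φ : ℝ → ℝ) (P : Measure Ω) (ξ : Ω → ℝ) : ℝ :=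
  sInf {a : ℝ | 0 ≤ a ∧ ExpBound φ P ξ a}

/-- `X = {X(t), t ∈ B}` is separable: for a countable dense `S ⊆ B`, almost surely every point
`(t, X(t))` of the graph of the path is in the closure of the graph of its restriction to `S`. -/
def IsSeparableProcess (P : Measure Ω) (B : Set ℝ) (X : ℝ → Ω → ℝ) : Prop :=
  ∃ S : Set ℝ, S ⊆ B ∧ S.Countable ∧ B ⊆ closure S ∧
    ∀ᵐ ω ∂P, ∀ t ∈ B, (t, X t ω) ∈ closure ((fun s => (s, X s ω)) '' S)

/-- `sup_{t, s ∈ B, |t - s| ≤ h} τ_φ(Y(t) - Y(s)) ≤ σ(h)` for all `h > 0`. -/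
def HasModulus (φ : ℝ → ℝ) (P : Measure Ω) (B : Set ℝ) (Y : ℝ → Ω → ℝ) (σ : ℝ → ℝ) : Prop :=
  ∀ h : ℝ, 0 < h → ∀ t ∈ B, ∀ s ∈ B, |t - s| ≤ h → tau φ P (fun ω => Y t ω - Y s ω) ≤ σ h

/-- The partial sum `∑_{k < n} ξ_k b_k(t)`: the first `n` terms of a series. -/
noncomputable def partialSum (ξ : ℕ → Ω → ℝ) (b : ℕ → ℝ → ℝ) (n : ℕ) (t : ℝ) (ω : Ω) : ℝ :=
  ∑ k ∈ Finset.range n, ξ k ω * b k t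

/-- `X(t) = ∑_k ξ_k a_k(t)` in mean square, for each `t ∈ B`. -/
def IsSeriesExpansion (P : Measure Ω) (B : Set ℝ) (X : ℝ → Ω → ℝ) (ξ : ℕ → Ω → ℝ)
    (a : ℕ → ℝ → ℝ) : Prop :=
  ∀ t ∈ B, Tendsto (fun n => eLpNorm (fun ω => X t ω - partialSum ξ a n t ω) 2 P) atTop (𝓝 0)

/-- `M` approximates `X` with reliability `1 - ν` and accuracy `δ` in `C(B)`:
`P (sup_{t ∈ B} |X(t) - M(t)| > δ) ≤ ν`. The supremum is taken in the extended reals. -/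
def Approximates (P : Measure Ω) (B : Set ℝ) (X M : ℝ → Ω → ℝ) (ν δ : ℝ) : Prop :=
  P {ω | (δ : EReal) < ⨆ t ∈ B, ((|X t ω - M t ω| : ℝ) : EReal)} ≤ ENNReal.ofReal ν

/-- The bound
`2 exp{- (ζ-1) δ^{1/(ζ-1)} (δ-γ)^{ζ/(ζ-1)} / (ζ (γ^ζ (δ-γ) + β^ζ γ)^{1/(ζ-1)})} 2 (e δ/γ)^{1/α}`. -/
noncomputable def tailBound (ζ α β γ δ : ℝ) : ℝ :=
  2 * Real.exp (-((ζ - 1) * δ ^ (1 / (ζ - 1)) * (δ - γ) ^ (ζ / (ζ - 1)) /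
      (ζ * (γ ^ ζ * (δ - γ) + β ^ ζ * γ) ^ (1 / (ζ - 1))))) *
    (2 * (Real.exp 1 * δ / γ) ^ (1 / α))

/-- `γ_N = sup_{u ∈ B} τ_φ(Y(u))`. -/
noncomputable def supTau (φ : ℝ → ℝ) (P : Measure Ω) (B : Set ℝ) (Y : ℝ → Ω → ℝ) : ℝ :=
  sSup ((fun u => tau φ P (Y u)) '' B)

end PhiSub

/-! Everything is phrased with the proxy v = a^ζ in E exp(lx) ≤ exp(v|l|^ζ/ζ), which adds up over
independent summands.

Modulus of the error: write X(t), or an increment of X, as a head of N terms plus a remainder R. R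
is an a.s. limit of sums of the later terms, hence independent of the head. The condition ζ > 1
forces sub-Gaussian variables to be centred, so the head's exponential moments are at least 1 and
dropping the head can only lower them: R inherits the proxy of the whole series. Adding back the
independent sum of ξ_k δ_k adds its proxies, which is where C_N^ζ comes from (`ExpProxy.sub_head`).
The bound for γ_N instead treats the error as one mean-square series and uses Fatou
(`expProxy_series`).

Tail bound: chaining with ratio p = γ/δ. Nets with at most 2p^(-(k+1)/α) points make the links at
level k+1 have standard at most βp^(k+1), while level 0 has standard at most γ. Hölder's inequality
with weights (1-p)p^k decouples the levels. The cardinalities then contribute at most 4(e/p)^(1/α),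
and optimising the Chebyshev parameter gives the exponent (`measure_exists_sum_gt_le`). As p < 1 is
all that this needs, δ > γ suffices.

The bad event is the same for all t, though the null sets vary. Separability of X and continuity of
the model paths reduce the supremum to countably many t. -/

namespace PhiSub

/-! ### Calculus of exponential proxies; centring. -/

section Proxy

variable {Ω : Type*} [MeasurableSpace Ω] {P : Measure Ω} {ζ : ℝ}

/-- `E exp(l x) ≤ exp(v |l|^ζ / ζ)` for all real `l`: for `v = a ^ ζ` this is
`ExpBound (powPhi ζ) P x a`, and `v` is additive for independent variables. -/
def ExpProxy (ζ : ℝ) (P : Measure Ω) (x : Ω → ℝ) (v : ℝ) : Prop :=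
  ∀ l : ℝ, ∫⁻ ω, ENNReal.ofReal (Real.exp (l * x ω)) ∂P ≤
    ENNReal.ofReal (Real.exp (v * |l| ^ ζ / ζ))

theorem expBound_iff {x : Ω → ℝ} {a : ℝ} (ha : 0 ≤ a) :
    ExpBound (powPhi ζ) P x a ↔ ExpProxy ζ P x (a ^ ζ) := by
  simp only [ExpBound, ExpProxy, powPhi, abs_mul, abs_of_nonneg ha,
    Real.mul_rpow ha (abs_nonneg _)]

theorem expBound_rpow_iff (hζ : 1 < ζ) {x : Ω → ℝ} {v : ℝ} (hv : 0 ≤ v) :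
    ExpBound (powPhi ζ) P x (v ^ (1 / ζ)) ↔ ExpProxy ζ P x v := by
  rw [expBound_iff (by positivity), ← Real.rpow_mul hv, one_div_mul_cancel (by positivity),
    Real.rpow_one]

theorem ExpProxy.mono (hζ : 1 < ζ) {x : Ω → ℝ} {v w : ℝ} (h : ExpProxy ζ P x v) (hvw : v ≤ w) :
    ExpProxy ζ P x w := fun l => by
  refine (h l).trans (ENNReal.ofReal_le_ofReal (Real.exp_le_exp.2 ?_))
  have : 0 ≤ |l| ^ ζ := by positivity
  gcongr

theorem ExpProxy.mul_const {x : Ω → ℝ} {v : ℝ} (h : ExpProxy ζ P x v) (c : ℝ) :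
    ExpProxy ζ P (fun ω => x ω * c) (v * |c| ^ ζ) := fun l => by
  have := h (l * c)
  rw [abs_mul, Real.mul_rpow (abs_nonneg _) (abs_nonneg _)] at this
  convert this using 3
  · congr 2; ring
  · ring_nf

theorem ExpProxy.neg {x : Ω → ℝ} {v : ℝ} (h : ExpProxy ζ P x v) :
    ExpProxy ζ P (fun ω => -x ω) v := by
  simpa using h.mul_const (-1)

theorem isSub_iff (hζ : 1 < ζ) {x : Ω → ℝ} :
    IsSub (powPhi ζ) P x ↔ Measurable x ∧ ∃ v : ℝ, 0 ≤ v ∧ ExpProxy ζ P x v := by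
  constructor
  · rintro ⟨hm, a, ha, h⟩
    exact ⟨hm, a ^ ζ, by positivity, (expBound_iff ha).1 h⟩
  · rintro ⟨hm, v, hv, h⟩
    exact ⟨hm, v ^ (1 / ζ), by positivity, (expBound_rpow_iff hζ hv).2 h⟩

theorem tau_nonneg (φ : ℝ → ℝ) (P : Measure Ω) (x : Ω → ℝ) : 0 ≤ tau φ P x :=
  Real.sInf_nonneg fun _ h => h.1

/-- The infimum defining `τ_φ` is attained. -/
theorem IsSub.expBound_tau (hζ : 1 < ζ) {x : Ω → ℝ} (h : IsSub (powPhi ζ) P x) :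
    ExpBound (powPhi ζ) P x (tau (powPhi ζ) P x) := by
  -- For fixed l the left side does not depend on a and the right side is continuous in a, so each
  -- constraint is closed.
  have hcl : IsClosed {a : ℝ | 0 ≤ a ∧ ExpBound (powPhi ζ) P x a} := by
    have : {a : ℝ | 0 ≤ a ∧ ExpBound (powPhi ζ) P x a} = Set.Ici 0 ∩ ⋂ l : ℝ,
        {a : ℝ | ∫⁻ ω, ENNReal.ofReal (Real.exp (l * x ω)) ∂P ≤
          ENNReal.ofReal (Real.exp (powPhi ζ (a * l)))} := by
      ext a; simp [ExpBound]
    rw [this]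
    refine isClosed_Ici.inter (isClosed_iInter fun l => isClosed_le continuous_const ?_)
    refine ENNReal.continuous_ofReal.comp (Real.continuous_exp.comp ?_)
    unfold powPhi
    exact ((continuous_abs.comp (continuous_id.mul continuous_const)).rpow_const
      fun _ => Or.inr (by linarith)).div_const _
  exact (hcl.csInf_mem h.2 ⟨0, fun _ h => h.1⟩).2

theorem IsSub.expProxy_tau (hζ : 1 < ζ) {x : Ω → ℝ} (h : IsSub (powPhi ζ) P x) :
    ExpProxy ζ P x (tau (powPhi ζ) P x ^ ζ) :=
  (expBound_iff (tau_nonneg _ _ _)).1 (h.expBound_tau hζ)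

theorem IsSub.expProxy_of_tau_le (hζ : 1 < ζ) {x : Ω → ℝ} (h : IsSub (powPhi ζ) P x) {b : ℝ}
    (hb : tau (powPhi ζ) P x ≤ b) : ExpProxy ζ P x (b ^ ζ) :=
  (h.expProxy_tau hζ).mono hζ
    (Real.rpow_le_rpow (tau_nonneg _ _ _) hb (by linarith))

theorem ExpProxy.tau_le (hζ : 1 < ζ) {x : Ω → ℝ} {v : ℝ} (hv : 0 ≤ v) (h : ExpProxy ζ P x v) :
    tau (powPhi ζ) P x ≤ v ^ (1 / ζ) :=
  csInf_le ⟨0, fun _ h => h.1⟩ ⟨by positivity, (expBound_rpow_iff hζ hv).2 h⟩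

theorem measurable_ofReal_exp {x : Ω → ℝ} (hx : Measurable x) (l : ℝ) :
    Measurable fun ω => ENNReal.ofReal (Real.exp (l * x ω)) := by fun_prop

/-- A sum of two `φ`-sub-Gaussian variables, independent or not. -/
theorem ExpProxy.add (hζ : 1 < ζ) {x y : Ω → ℝ} {v w : ℝ} (hx : Measurable x)
    (hv : ExpProxy ζ P x v) (hw : ExpProxy ζ P y w) :
    ExpProxy ζ P (fun ω => x ω + y ω) (2 ^ ζ * max v w) := fun l => by
  -- Without independence, e^(lx)e^(ly) ≤ (e^(2lx) + e^(2ly))/2; evaluating at 2l costs the factor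
  -- 2^ζ. This crude constant serves only for membership and finiteness.
  have hv' := (hv.mono hζ (le_max_left v w)) (2 * l)
  have hw' := (hw.mono hζ (le_max_right v w)) (2 * l)
  have key : max v w * |2 * l| ^ ζ / ζ = 2 ^ ζ * max v w * |l| ^ ζ / ζ := by
    rw [abs_mul, Real.mul_rpow (abs_nonneg _) (abs_nonneg _)]
    norm_num
    ring
  rw [key] at hv' hw'
  set E := ENNReal.ofReal (Real.exp (2 ^ ζ * max v w * |l| ^ ζ / ζ))
  calc ∫⁻ ω, ENNReal.ofReal (Real.exp (l * (x ω + y ω))) ∂P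
      ≤ ∫⁻ ω, ENNReal.ofReal (1 / 2) * (ENNReal.ofReal (Real.exp (2 * l * x ω))
          + ENNReal.ofReal (Real.exp (2 * l * y ω))) ∂P := by
        refine lintegral_mono fun ω => ?_
        rw [← ENNReal.ofReal_add (by positivity) (by positivity),
          ← ENNReal.ofReal_mul (by norm_num)]
        refine ENNReal.ofReal_le_ofReal ?_
        have h1 : Real.exp (2 * l * x ω) = Real.exp (l * x ω) ^ 2 := by
          rw [← Real.exp_nat_mul]; congr 1; push_cast; ring
        have h2 : Real.exp (2 * l * y ω) = Real.exp (l * y ω) ^ 2 := by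
          rw [← Real.exp_nat_mul]; congr 1; push_cast; ring
        rw [h1, h2, mul_add, Real.exp_add]
        nlinarith [sq_nonneg (Real.exp (l * x ω) - Real.exp (l * y ω))]
    _ = ENNReal.ofReal (1 / 2) * (∫⁻ ω, ENNReal.ofReal (Real.exp (2 * l * x ω)) ∂P
          + ∫⁻ ω, ENNReal.ofReal (Real.exp (2 * l * y ω)) ∂P) := by
        rw [lintegral_const_mul' _ _ ENNReal.ofReal_ne_top,
          lintegral_add_left (measurable_ofReal_exp hx _)]
    _ ≤ ENNReal.ofReal (1 / 2) * (E + E) := by gcongr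
    _ = E := by
        rw [← two_mul, ← mul_assoc]
        have : ENNReal.ofReal (1 / 2) * 2 = 1 := by
          rw [show (2 : ENNReal) = ENNReal.ofReal 2 by norm_num, ← ENNReal.ofReal_mul (by norm_num)]
          norm_num
        rw [this, one_mul]

theorem IsSub.sub (hζ : 1 < ζ) {x y : Ω → ℝ} (hx : IsSub (powPhi ζ) P x)
    (hy : IsSub (powPhi ζ) P y) : IsSub (powPhi ζ) P (fun ω => x ω - y ω) := by
  rw [isSub_iff hζ] at *
  obtain ⟨hxm, v, hv, hxv⟩ := hx
  obtain ⟨hym, w, hw, hyw⟩ := hy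
  refine ⟨hxm.sub hym, 2 ^ ζ * max v w, by positivity, ?_⟩
  simpa only [sub_eq_add_neg] using hxv.add hζ hxm hyw.neg

/-- Since ζ > 1, the exponent is o(l) at the origin; |e^y - 1| ≤ |y|e^|y| transfers this to the
quotient. This is what excludes a nonzero mean. -/
theorem tendsto_exp_rpow_sub_one_div (hζ : 1 < ζ) (c : ℝ) :
    Tendsto (fun l : ℝ => (Real.exp (c * |l| ^ ζ) - 1) / l) (𝓝[>] 0) (𝓝 0) := by
  have hlim : Tendsto (fun l : ℝ => |c| * l ^ (ζ - 1) * Real.exp (|c| * l ^ ζ)) (𝓝[>] 0) (𝓝 0) := by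
    have : ContinuousAt (fun l : ℝ => |c| * l ^ (ζ - 1) * Real.exp (|c| * l ^ ζ)) 0 :=
      (continuousAt_const.mul (Real.continuousAt_rpow_const _ _ (Or.inr (by linarith)))).mul
        (Real.continuous_exp.continuousAt.comp
          (continuousAt_const.mul (Real.continuousAt_rpow_const _ _ (Or.inr (by linarith)))))
    have h0 := this.tendsto
    simp only [Real.zero_rpow (show ζ - 1 ≠ 0 by linarith), mul_zero, zero_mul] at h0
    exact h0.mono_left nhdsWithin_le_nhds
  refine squeeze_zero_norm' ?_ hlim
  filter_upwards [self_mem_nhdsWithin] with l (hl : 0 < l)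
  have hy : |Real.exp (c * l ^ ζ) - 1| ≤ |c * l ^ ζ| * Real.exp |c * l ^ ζ| := by
    have h1 := Real.add_one_le_exp (c * l ^ ζ)
    have h2 := Real.add_one_le_exp (-(c * l ^ ζ))
    have h3 : Real.exp (c * l ^ ζ) * Real.exp (-(c * l ^ ζ)) = 1 := by
      rw [← Real.exp_add]; simp
    have h4 : Real.exp (c * l ^ ζ) ≤ Real.exp |c * l ^ ζ| := Real.exp_le_exp.2 (le_abs_self _)
    have h5 : 1 ≤ Real.exp |c * l ^ ζ| := Real.one_le_exp (abs_nonneg _)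
    have h6 := Real.exp_pos (c * l ^ ζ)
    have h7 := le_abs_self (c * l ^ ζ)
    have h8 := neg_abs_le (c * l ^ ζ)
    have h9 := abs_nonneg (c * l ^ ζ)
    rw [abs_le]
    constructor
    · nlinarith
    · have : Real.exp (c * l ^ ζ) - 1 ≤ c * l ^ ζ * Real.exp (c * l ^ ζ) := by nlinarith
      exact this.trans (mul_le_mul h7 h4 h6.le h9)
  have hlζ : l ^ ζ = l ^ (ζ - 1) * l := by
    rw [← Real.rpow_add_one hl.ne']; congr 1; ring
  rw [Real.norm_eq_abs, abs_div, abs_of_pos hl, div_le_iff₀ hl]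
  refine hy.trans (le_of_eq ?_)
  rw [abs_mul, abs_of_pos (Real.rpow_pos_of_pos hl ζ), hlζ]
  ring

/-- A `φ`-sub-Gaussian variable is centered; in terms of exponential moments, `1 ≤ E exp(l x)`. -/
theorem ExpProxy.one_le_lintegral_of_nonneg [IsProbabilityMeasure P] (hζ : 1 < ζ) {x : Ω → ℝ}
    {v : ℝ} (hx : Measurable x) (h : ExpProxy ζ P x v) {l : ℝ} (hl : 0 ≤ l) :
    1 ≤ ∫⁻ ω, ENNReal.ofReal (Real.exp (l * x ω)) ∂P := by
  set F := ∫⁻ ω, ENNReal.ofReal (Real.exp (l * x ω)) ∂P with hF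
  have hFtop : F ≠ ⊤ := ne_top_of_le_ne_top ENNReal.ofReal_ne_top (h l)
  -- Add e^(lx) ≥ 1 + lx to (l/e)·e^(-ex) ≥ l/e - lx: the linear terms cancel, so the mean of x
  -- never has to be written down. Letting e tend to 0 removes the error.
  have key : ∀ e : ℝ, 0 < e →
      1 - l * ((Real.exp (v / ζ * |e| ^ ζ) - 1) / e) ≤ F.toReal := fun e he => by
    have hle : ENNReal.ofReal (1 + l / e) ≤
        F + ENNReal.ofReal (l / e) * ENNReal.ofReal (Real.exp (v * |e| ^ ζ / ζ)) := by
      calc ENNReal.ofReal (1 + l / e) = ∫⁻ _, ENNReal.ofReal (1 + l / e) ∂P := by simp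
        _ ≤ ∫⁻ ω, (ENNReal.ofReal (Real.exp (l * x ω)) +
            ENNReal.ofReal (l / e) * ENNReal.ofReal (Real.exp (-e * x ω))) ∂P := by
          refine lintegral_mono fun ω => ?_
          rw [← ENNReal.ofReal_mul (by positivity),
            ← ENNReal.ofReal_add (by positivity) (by positivity)]
          refine ENNReal.ofReal_le_ofReal ?_
          have h1 := Real.add_one_le_exp (l * x ω)
          have h2 := mul_le_mul_of_nonneg_left (Real.add_one_le_exp (-e * x ω))
            (show 0 ≤ l / e by positivity)
          have h3 : l / e * (-e * x ω + 1) = -(l * x ω) + l / e := by field_simp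
          linarith
        _ = F + ENNReal.ofReal (l / e) *
            ∫⁻ ω, ENNReal.ofReal (Real.exp (-e * x ω)) ∂P := by
          rw [lintegral_add_left (measurable_ofReal_exp hx _),
            lintegral_const_mul' _ _ ENNReal.ofReal_ne_top]
        _ ≤ _ := by
          gcongr
          simpa using h (-e)
    rw [← ENNReal.ofReal_mul (by positivity), ← ENNReal.ofReal_toReal hFtop,
      ← ENNReal.ofReal_add ENNReal.toReal_nonneg (by positivity),
      ENNReal.ofReal_le_ofReal_iff (by positivity)] at hle
    have : v * |e| ^ ζ / ζ = v / ζ * |e| ^ ζ := by ring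
    rw [this] at hle
    have h4 : l * ((Real.exp (v / ζ * |e| ^ ζ) - 1) / e) =
      l / e * Real.exp (v / ζ * |e| ^ ζ) - l / e := by ring
    rw [h4]
    linarith
  have hlim := ((tendsto_exp_rpow_sub_one_div hζ (v / ζ)).const_mul l).const_sub 1
  simp only [mul_zero, sub_zero] at hlim
  have : 1 ≤ F.toReal := le_of_tendsto hlim (by
    filter_upwards [self_mem_nhdsWithin] with e he using key e he)
  rw [← ENNReal.ofReal_toReal hFtop]
  exact ENNReal.one_le_ofReal.2 this

theorem ExpProxy.one_le_lintegral [IsProbabilityMeasure P] (hζ : 1 < ζ) {x : Ω → ℝ}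
    {v : ℝ} (hx : Measurable x) (h : ExpProxy ζ P x v) (l : ℝ) :
    1 ≤ ∫⁻ ω, ENNReal.ofReal (Real.exp (l * x ω)) ∂P := by
  rcases le_total 0 l with hl | hl
  · exact h.one_le_lintegral_of_nonneg hζ hx hl
  · simpa using h.neg.one_le_lintegral_of_nonneg hζ hx.neg (neg_nonneg.2 hl)

end Proxy

theorem measurable_sum_mul_const {Ω : Type*} {m : MeasurableSpace Ω} {ξ : ℕ → Ω → ℝ}
    (s : Finset ℕ) (hξ : ∀ k ∈ s, Measurable (ξ k)) (c : ℕ → ℝ) :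
    Measurable fun ω => ∑ k ∈ s, ξ k ω * c k :=
  Finset.measurable_sum _ fun k hk => (hξ k hk).mul_const _

/-! ### Series of independent terms and replacement of the head. -/

section Series

variable {Ω : Type*} [MeasurableSpace Ω] {P : Measure Ω} {ζ : ℝ}

/-- Independent sums: `τ_φ^ζ` is subadditive. -/
theorem expProxy_sum (hζ : 1 < ζ) {ξ : ℕ → Ω → ℝ} (hξ : ∀ k, IsSub (powPhi ζ) P (ξ k))
    (hindep : iIndepFun ξ P) (c : ℕ → ℝ) (s : Finset ℕ) :
    ExpProxy ζ P (fun ω => ∑ k ∈ s, ξ k ω * c k)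
      (∑ k ∈ s, (tau (powPhi ζ) P (ξ k) * |c k|) ^ ζ) := fun l => by
  have hind : iIndepFun (fun k ω => ENNReal.ofReal (Real.exp (l * (ξ k ω * c k)))) P :=
    hindep.comp (fun k y => ENNReal.ofReal (Real.exp (l * (y * c k)))) fun k => by fun_prop
  have hmeas : ∀ k, Measurable fun ω => ENNReal.ofReal (Real.exp (l * (ξ k ω * c k))) := fun k =>
    measurable_ofReal_exp ((hξ k).1.mul_const _) l
  calc ∫⁻ ω, ENNReal.ofReal (Real.exp (l * ∑ k ∈ s, ξ k ω * c k)) ∂P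
      = ∫⁻ ω, ∏ k ∈ s, ENNReal.ofReal (Real.exp (l * (ξ k ω * c k))) ∂P := by
        refine lintegral_congr fun ω => ?_
        rw [Finset.mul_sum, Real.exp_sum, ENNReal.ofReal_prod_of_nonneg]
        exact fun _ _ => (Real.exp_pos _).le
    _ = ∏ k ∈ s, ∫⁻ ω, ENNReal.ofReal (Real.exp (l * (ξ k ω * c k))) ∂P :=
        lintegral_prod_eq_prod_lintegral_of_indepFun s _ hind hmeas
    _ ≤ ∏ k ∈ s, ENNReal.ofReal
          (Real.exp ((tau (powPhi ζ) P (ξ k) * |c k|) ^ ζ * |l| ^ ζ / ζ)) := by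
        refine Finset.prod_le_prod' fun k _ => ?_
        rw [Real.mul_rpow (tau_nonneg _ _ _) (abs_nonneg _)]
        exact ((hξ k).expProxy_tau hζ).mul_const (c k) l
    _ = _ := by
        rw [← ENNReal.ofReal_prod_of_nonneg fun _ _ => (Real.exp_pos _).le, ← Real.exp_sum,
          Finset.sum_mul, Finset.sum_div]

/-- Norm convergence gives convergence in measure, hence an a.s. convergent subsequence; Fatou and
independence of limits need no more. -/
theorem exists_seq_tendsto_ae_of_eLpNorm_sub {p : ENNReal} (hp : p ≠ 0) {Y : Ω → ℝ}
    {f : ℕ → Ω → ℝ} (hY : Measurable Y) (hf : ∀ n, Measurable (f n))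
    (hlim : Tendsto (fun n => eLpNorm (fun ω => Y ω - f n ω) p P) atTop (𝓝 0)) :
    ∃ ns : ℕ → ℕ, StrictMono ns ∧
      ∀ᵐ ω ∂P, Tendsto (fun i => f (ns i) ω) atTop (𝓝 (Y ω)) := by
  refine (tendstoInMeasure_of_tendsto_eLpNorm hp (fun n => (hf n).aestronglyMeasurable)
    hY.aestronglyMeasurable ?_).exists_seq_tendsto_ae
  refine hlim.congr fun n => ?_
  rw [← eLpNorm_neg]
  congr 1
  ext ω
  simp

/-- Fatou's lemma for the exponentials. -/
theorem ExpProxy.of_tendsto_ae {Y : Ω → ℝ} {f : ℕ → Ω → ℝ} (hf : ∀ n, Measurable (f n))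
    (hlim : ∀ᵐ ω ∂P, Tendsto (fun n => f n ω) atTop (𝓝 (Y ω))) {v : ℝ}
    (h : ∀ᶠ n in atTop, ExpProxy ζ P (f n) v) : ExpProxy ζ P Y v := fun l => by
  calc ∫⁻ ω, ENNReal.ofReal (Real.exp (l * Y ω)) ∂P
      = ∫⁻ ω, liminf (fun n => ENNReal.ofReal (Real.exp (l * f n ω))) atTop ∂P := by
        refine lintegral_congr_ae (hlim.mono fun ω hω => ?_)
        refine (Tendsto.liminf_eq ?_).symm
        exact (ENNReal.continuous_ofReal.comp Real.continuous_exp).continuousAt.tendsto.comp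
          (hω.const_mul l)
    _ ≤ liminf (fun n => ∫⁻ ω, ENNReal.ofReal (Real.exp (l * f n ω)) ∂P) atTop :=
        lintegral_liminf_le fun n => measurable_ofReal_exp (hf n) l
    _ ≤ _ := by
        refine liminf_le_of_frequently_le' (Eventually.frequently ?_)
        exact h.mono fun n hn => hn l

theorem measurable_partialSum {ξ : ℕ → Ω → ℝ} (hξ : ∀ k, Measurable (ξ k)) (b : ℕ → ℝ → ℝ)
    (n : ℕ) (t : ℝ) : Measurable (partialSum ξ b n t) := by
  unfold partialSum
  exact Finset.measurable_sum _ fun k _ => (hξ k).mul_const _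

/-- A mean-square convergent series of independent terms. -/
theorem expProxy_series (hζ : 1 < ζ) {ξ : ℕ → Ω → ℝ} (hξ : ∀ k, IsSub (powPhi ζ) P (ξ k))
    (hindep : iIndepFun ξ P) {Y : Ω → ℝ} (hY : Measurable Y) (c : ℕ → ℝ)
    (hlim : Tendsto (fun n => eLpNorm (fun ω => Y ω - ∑ k ∈ Finset.range n, ξ k ω * c k) 2 P)
      atTop (𝓝 0)) {v : ℝ}
    (hv : ∀ n, ∑ k ∈ Finset.range n, (tau (powPhi ζ) P (ξ k) * |c k|) ^ ζ ≤ v) :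
    ExpProxy ζ P Y v := by
  have hm : ∀ n, Measurable fun ω => ∑ k ∈ Finset.range n, ξ k ω * c k := fun n =>
    measurable_sum_mul_const _ (fun k _ => (hξ k).1) _
  obtain ⟨ns, -, hns⟩ := exists_seq_tendsto_ae_of_eLpNorm_sub two_ne_zero hY hm hlim
  exact ExpProxy.of_tendsto_ae (fun n => hm (ns n)) hns
    (Eventually.of_forall fun n => (expProxy_sum hζ hξ hindep c _).mono hζ (hv _))

/-- A function which, up to a null set, is a limit of functions of `ξ k`, `k ∉ s`, is independent
of every function of `ξ k`, `k ∈ s`. -/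
theorem indepFun_sum_of_tendsto_ae {ξ : ℕ → Ω → ℝ} (hξ : ∀ k, Measurable (ξ k))
    (hindep : iIndepFun ξ P) (s : Finset ℕ) (d : ℕ → ℝ) {R : Ω → ℝ} {u : ℕ → Finset ℕ}
    (hu : ∀ n, Disjoint s (u n)) (b : ℕ → ℝ)
    (hlim : ∀ᵐ ω ∂P, Tendsto (fun n => ∑ k ∈ u n, ξ k ω * b k) atTop (𝓝 (R ω))) :
    IndepFun R (fun ω => ∑ k ∈ s, ξ k ω * d k) P := by
  set m : ℕ → MeasurableSpace Ω := fun k => MeasurableSpace.comap (ξ k) inferInstance with hm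
  have hle : ∀ k, m k ≤ ‹MeasurableSpace Ω› := fun k => (hξ k).comap_le
  have hind := indep_iSup_of_disjoint hle hindep
    (S := (s : Set ℕ)ᶜ) (T := (s : Set ℕ)) disjoint_compl_left
  have hmeas : ∀ (S : Set ℕ) (v : Finset ℕ), (v : Set ℕ) ⊆ S → ∀ c : ℕ → ℝ,
      Measurable[⨆ i ∈ S, m i] fun ω => ∑ k ∈ v, ξ k ω * c k := fun S v hv c => by
    refine measurable_sum_mul_const v (fun k hk => ?_) c
    have h1 : Measurable[m k] (ξ k) := comap_measurable _
    exact h1.mono (le_iSup₂ (f := fun i (_ : i ∈ S) => m i) k (hv hk)) le_rfl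
  -- R is measurable for the complementary σ-algebra only up to a null set; the limsup is an exactly
  -- measurable version.
  set R' : Ω → ℝ := fun ω => limsup (fun n => ∑ k ∈ u n, ξ k ω * b k) atTop
  have hR'm : Measurable[⨆ i ∈ (s : Set ℕ)ᶜ, m i] R' :=
    Measurable.limsup fun n => hmeas _ (u n)
      (fun k hk hks => Finset.disjoint_left.1 (hu n) hks hk) b
  have hRR' : R =ᵐ[P] R' := hlim.mono fun ω hω => hω.limsup_eq.symm
  have : IndepFun R' (fun ω => ∑ k ∈ s, ξ k ω * d k) P := by
    rw [IndepFun_iff_Indep]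
    exact indep_of_indep_of_le_left (indep_of_indep_of_le_right hind
      (hmeas _ s le_rfl d).comap_le) hR'm.comap_le
  exact this.congr hRR'.symm EventuallyEq.rfl

/-- Replacing finitely many coefficients of a series `Y = ∑ ξ_k b_k`. -/
theorem ExpProxy.sub_head [IsProbabilityMeasure P] (hζ : 1 < ζ) {ξ : ℕ → Ω → ℝ}
    (hξ : ∀ k, IsSub (powPhi ζ) P (ξ k)) (hindep : iIndepFun ξ P) {Y : Ω → ℝ} (hY : Measurable Y)
    (b d : ℕ → ℝ) (N : ℕ)
    (hlim : Tendsto (fun n => eLpNorm (fun ω => Y ω - ∑ k ∈ Finset.range n, ξ k ω * b k) 2 P)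
      atTop (𝓝 0)) {v : ℝ} (h : ExpProxy ζ P Y v) :
    ExpProxy ζ P (fun ω => Y ω - ∑ k ∈ Finset.range N, ξ k ω * (b k - d k))
      (v + ∑ k ∈ Finset.range N, (tau (powPhi ζ) P (ξ k) * |d k|) ^ ζ) := fun l => by
  have hm : ∀ (c : ℕ → ℝ) n, Measurable fun ω => ∑ k ∈ Finset.range n, ξ k ω * c k := fun c n =>
    measurable_sum_mul_const _ (fun k _ => (hξ k).1) _
  obtain ⟨ns, hmono, hns⟩ := exists_seq_tendsto_ae_of_eLpNorm_sub two_ne_zero hY (hm b) hlim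
  set R : Ω → ℝ := fun ω => Y ω - ∑ k ∈ Finset.range N, ξ k ω * b k with hRdef
  have hRm : Measurable R := hY.sub (hm b N)
  -- The shift by N ensures `N ≤ ns (n + N)`, so that each partial sum contains the whole head.
  have hRlim : ∀ᵐ ω ∂P, Tendsto (fun n => ∑ k ∈ Finset.Ico N (ns (n + N)), ξ k ω * b k) atTop
      (𝓝 (R ω)) := hns.mono fun ω hω => by
    refine ((hω.comp (tendsto_add_atTop_nat N)).sub_const
      (∑ k ∈ Finset.range N, ξ k ω * b k)).congr fun n => ?_
    have : N ≤ ns (n + N) := (Nat.le_add_left _ _).trans (hmono.id_le _)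
    simp only [Function.comp_apply]
    rw [Finset.sum_Ico_eq_sub _ this]
  have hindepR : ∀ c : ℕ → ℝ, IndepFun R (fun ω => ∑ k ∈ Finset.range N, ξ k ω * c k) P :=
    fun c => indepFun_sum_of_tendsto_ae (fun k => (hξ k).1) hindep _ c
      (fun n => by
        rw [Finset.disjoint_left]
        intro k hk hk'
        simp only [Finset.mem_range, Finset.mem_Ico] at hk hk'
        omega) b hRlim
  have hprod : ∀ c : ℕ → ℝ,
      ∫⁻ ω, ENNReal.ofReal (Real.exp (l * (R ω + ∑ k ∈ Finset.range N, ξ k ω * c k))) ∂P =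
        (∫⁻ ω, ENNReal.ofReal (Real.exp (l * R ω)) ∂P) *
        ∫⁻ ω, ENNReal.ofReal (Real.exp (l * ∑ k ∈ Finset.range N, ξ k ω * c k)) ∂P := fun c => by
    have hexp : Measurable fun y : ℝ => ENNReal.ofReal (Real.exp (l * y)) := by fun_prop
    rw [← lintegral_mul_eq_lintegral_mul_lintegral_of_indepFun''
      (measurable_ofReal_exp hRm l).aemeasurable (measurable_ofReal_exp (hm c N) l).aemeasurable
      ((hindepR c).comp hexp hexp)]
    refine lintegral_congr fun ω => ?_
    rw [mul_add, Real.exp_add, ENNReal.ofReal_mul (Real.exp_pos _).le]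
  -- The exponential moment of Y factors into those of R and of the independent centred head; the
  -- latter factor is at least 1.
  have hRle : ∫⁻ ω, ENNReal.ofReal (Real.exp (l * R ω)) ∂P ≤
      ENNReal.ofReal (Real.exp (v * |l| ^ ζ / ζ)) := by
    calc ∫⁻ ω, ENNReal.ofReal (Real.exp (l * R ω)) ∂P
        ≤ (∫⁻ ω, ENNReal.ofReal (Real.exp (l * R ω)) ∂P) *
          ∫⁻ ω, ENNReal.ofReal (Real.exp (l * ∑ k ∈ Finset.range N, ξ k ω * b k)) ∂P :=
          le_mul_of_one_le_right' ((expProxy_sum hζ hξ hindep b _).one_le_lintegral hζ (hm b N) l)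
      _ = ∫⁻ ω, ENNReal.ofReal (Real.exp (l * Y ω)) ∂P := by
          rw [← hprod b]
          refine lintegral_congr fun ω => ?_
          simp only [hRdef, sub_add_cancel]
      _ ≤ _ := h l
  calc ∫⁻ ω, ENNReal.ofReal
        (Real.exp (l * (Y ω - ∑ k ∈ Finset.range N, ξ k ω * (b k - d k)))) ∂P
      = ∫⁻ ω, ENNReal.ofReal
        (Real.exp (l * (R ω + ∑ k ∈ Finset.range N, ξ k ω * d k))) ∂P := by
        refine lintegral_congr fun ω => ?_
        simp only [hRdef, mul_sub, Finset.sum_sub_distrib]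
        congr 2
        ring
    _ ≤ ENNReal.ofReal (Real.exp (v * |l| ^ ζ / ζ)) * ENNReal.ofReal (Real.exp
        ((∑ k ∈ Finset.range N, (tau (powPhi ζ) P (ξ k) * |d k|) ^ ζ) * |l| ^ ζ / ζ)) := by
        rw [hprod d]
        exact mul_le_mul' hRle (expProxy_sum hζ hξ hindep d _ l)
    _ = _ := by
        rw [← ENNReal.ofReal_mul (Real.exp_pos _).le, ← Real.exp_add]
        congr 2
        ring

end Series

/-! ### Nets of the time interval. -/

/-- An interval of length `T` has a `T / (2 r)`-net of at most `2 r` points. -/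
theorem exists_grid {T r : ℝ} (hT : 0 < T) (hr : 1 ≤ r) :
    ∃ s : Finset ℝ, (∀ u ∈ s, u ∈ Set.Icc 0 T) ∧ (s.card : ℝ) ≤ 2 * r ∧
      ∀ t ∈ Set.Icc 0 T, ∃ u ∈ s, |t - u| ≤ T / (2 * r) := by
  classical
  -- The net consists of the midpoints of n equal cells; n < r + 1 ≤ 2r because r ≥ 1.
  set n := ⌈r⌉₊
  have hrn : r ≤ n := Nat.le_ceil r
  have hn0 : (0 : ℝ) < n := by linarith
  have hn1 : 1 ≤ n := by exact_mod_cast hn0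
  refine ⟨(Finset.range n).image fun i : ℕ => T * (2 * i + 1) / (2 * n), ?_, ?_, ?_⟩
  · intro u hu
    obtain ⟨i, hi, rfl⟩ := Finset.mem_image.1 hu
    have hi' : (i : ℝ) + 1 ≤ n := by exact_mod_cast Finset.mem_range.1 hi
    refine ⟨by positivity, ?_⟩
    rw [div_le_iff₀ (by positivity)]
    exact mul_le_mul_of_nonneg_left (by linarith) hT.le
  · have h1 : (((Finset.range n).image fun i : ℕ => T * (2 * i + 1) / (2 * n)).card : ℝ) ≤ n := by
      exact_mod_cast Finset.card_image_le.trans (by simp)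
    have h2 : (n : ℝ) < r + 1 := Nat.ceil_lt_add_one (by linarith)
    linarith
  · rintro t ⟨ht0, htT⟩
    have key : ∃ i < n, T * i ≤ t * n ∧ t * n ≤ T * (i + 1) := by
      -- At the right endpoint the floor would be n, one cell too far.
      rcases htT.eq_or_lt with rfl | hlt
      · refine ⟨n - 1, by omega, ?_, ?_⟩ <;> push_cast [Nat.cast_sub hn1] <;> nlinarith
      · have h0 : 0 ≤ t * n / T := by positivity
        refine ⟨⌊t * n / T⌋₊, ?_, ?_, ?_⟩
        · rw [Nat.floor_lt h0, div_lt_iff₀ hT]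
          nlinarith
        · have := Nat.floor_le h0
          rwa [le_div_iff₀ hT, mul_comm] at this
        · have := (Nat.lt_floor_add_one (t * n / T)).le
          rwa [div_le_iff₀ hT, mul_comm (_ + 1)] at this
    obtain ⟨i, hi, h1, h2⟩ := key
    refine ⟨_, Finset.mem_image_of_mem _ (Finset.mem_range.2 hi), ?_⟩
    have h3 : |t - T * (2 * i + 1) / (2 * n)| ≤ T / (2 * n) := by
      rw [abs_le, ← sub_nonneg, ← sub_nonneg (b := t - _)]
      have e1 : t - T * (2 * i + 1) / (2 * n) - -(T / (2 * n)) = (t * n - T * i) / n := by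
        field_simp; ring
      have e2 : T / (2 * n) - (t - T * (2 * i + 1) / (2 * n)) = (T * (i + 1) - t * n) / n := by
        field_simp; ring
      rw [e1, e2]
      exact ⟨div_nonneg (by linarith) hn0.le, div_nonneg (by linarith) hn0.le⟩
    refine h3.trans ?_
    gcongr

/-! ### Exponential moments of maxima and of sums over levels. -/

section Chaining

variable {Ω : Type*} [MeasurableSpace Ω] {P : Measure Ω} {ζ : ℝ}

theorem ExpProxy.lintegral_exp_abs_le {V : Ω → ℝ} {v : ℝ} (hV : Measurable V)
    (h : ExpProxy ζ P V v) {l : ℝ} (hl : 0 ≤ l) :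
    ∫⁻ ω, ENNReal.ofReal (Real.exp (l * |V ω|)) ∂P ≤
      ENNReal.ofReal (2 * Real.exp (v * l ^ ζ / ζ)) := by
  calc ∫⁻ ω, ENNReal.ofReal (Real.exp (l * |V ω|)) ∂P
      ≤ ∫⁻ ω, (ENNReal.ofReal (Real.exp (l * V ω)) +
          ENNReal.ofReal (Real.exp (-l * V ω))) ∂P := by
        refine lintegral_mono fun ω => ?_
        rcases abs_choice (V ω) with hc | hc <;> simp only [hc]
        · exact le_self_add
        · rw [mul_neg, ← neg_mul]; exact le_add_self
    _ = ∫⁻ ω, ENNReal.ofReal (Real.exp (l * V ω)) ∂P +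
          ∫⁻ ω, ENNReal.ofReal (Real.exp (-l * V ω)) ∂P :=
        lintegral_add_left (measurable_ofReal_exp hV _) _
    _ ≤ ENNReal.ofReal (Real.exp (v * l ^ ζ / ζ)) + ENNReal.ofReal (Real.exp (v * l ^ ζ / ζ)) := by
        have h1 := h l
        have h2 := h (-l)
        rw [abs_neg] at h2
        rw [abs_of_nonneg hl] at h1 h2
        gcongr
    _ = _ := by
        rw [← ENNReal.ofReal_add (by positivity) (by positivity), two_mul]

/-- The exponential of a maximum is at most the sum of the exponentials; the factor 2 pays for the
absolute value. -/
theorem ExpProxy.lintegral_exp_sup'_abs_le {ι : Type*} {s : Finset ι} (hs : s.Nonempty)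
    {V : ι → Ω → ℝ} {v : ℝ} (hV : ∀ i ∈ s, Measurable (V i)) (h : ∀ i ∈ s, ExpProxy ζ P (V i) v)
    {l : ℝ} (hl : 0 ≤ l) :
    ∫⁻ ω, ENNReal.ofReal (Real.exp (l * s.sup' hs fun i => |V i ω|)) ∂P ≤
      ENNReal.ofReal (2 * s.card * Real.exp (v * l ^ ζ / ζ)) := by
  calc ∫⁻ ω, ENNReal.ofReal (Real.exp (l * s.sup' hs fun i => |V i ω|)) ∂P
      ≤ ∫⁻ ω, ∑ i ∈ s, ENNReal.ofReal (Real.exp (l * |V i ω|)) ∂P := by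
        refine lintegral_mono fun ω => ?_
        obtain ⟨i, hi, hi'⟩ := s.exists_mem_eq_sup' hs fun i => |V i ω|
        rw [hi']
        exact Finset.single_le_sum (f := fun i => ENNReal.ofReal (Real.exp (l * |V i ω|)))
          (fun _ _ => zero_le) hi
    _ = ∑ i ∈ s, ∫⁻ ω, ENNReal.ofReal (Real.exp (l * |V i ω|)) ∂P :=
        lintegral_finsetSum' _ fun i hi =>
          (measurable_ofReal_exp (hV i hi).abs l).aemeasurable
    _ ≤ ∑ i ∈ s, ENNReal.ofReal (2 * Real.exp (v * l ^ ζ / ζ)) :=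
        Finset.sum_le_sum fun i hi => (h i hi).lintegral_exp_abs_le (hV i hi) hl
    _ = _ := by
        rw [Finset.sum_const, nsmul_eq_mul, ← ENNReal.ofReal_natCast,
          ← ENNReal.ofReal_mul (by positivity)]
        congr 1
        ring

/-- Hölder's inequality for exponential moments of a sum, with weights `w k`. -/
theorem lintegral_exp_sum_le [IsProbabilityMeasure P] {M : ℕ → Ω → ℝ} (hM : ∀ k, Measurable (M k))
    {w : ℕ → ℝ} (hw : ∀ k, 0 < w k) (m : ℕ) (hsum : ∑ k ∈ Finset.range m, w k ≤ 1) (l : ℝ) :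
    ∫⁻ ω, ENNReal.ofReal (Real.exp (l * ∑ k ∈ Finset.range m, M k ω)) ∂P ≤
      ∏ k ∈ Finset.range m, (∫⁻ ω, ENNReal.ofReal (Real.exp (l / w k * M k ω)) ∂P) ^ w k := by
  -- The unused weight 1 - Σ w goes to the constant function 1, which costs nothing under a
  -- probability measure.
  have := ENNReal.lintegral_mul_prod_norm_pow_le (μ := P) (Finset.range m) (g := fun _ => 1)
    (f := fun k ω => ENNReal.ofReal (Real.exp (l / w k * M k ω))) aemeasurable_const
    (fun k _ => (measurable_ofReal_exp (hM k) _).aemeasurable) (1 - ∑ k ∈ Finset.range m, w k)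
    (p := w) (by ring) (by linarith) (fun k _ => (hw k).le)
  simp only [ENNReal.one_rpow, one_mul, lintegral_const, measure_univ] at this
  refine le_trans (le_of_eq (lintegral_congr fun ω => ?_)) this
  rw [Finset.mul_sum, Real.exp_sum, ENNReal.ofReal_prod_of_nonneg fun _ _ => (Real.exp_pos _).le]
  refine Finset.prod_congr rfl fun k _ => ?_
  rw [ENNReal.ofReal_rpow_of_pos (Real.exp_pos _), ← Real.exp_mul]
  congr 2
  have := (hw k).ne'
  field_simp

/-- From y ≤ b·e^(y/b), with the exponential moment taken at l = 1/b. It makes the approximations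
along the nets converge in mean. -/
theorem ExpProxy.eLpNorm_one_le {V : Ω → ℝ} {b : ℝ} (hV : Measurable V) (hb : 0 < b)
    (h : ExpProxy ζ P V (b ^ ζ)) : eLpNorm V 1 P ≤ ENNReal.ofReal (b * (2 * Real.exp (1 / ζ))) := by
  rw [eLpNorm_one_eq_lintegral_enorm]
  have h1 := h.lintegral_exp_abs_le hV (inv_pos.2 hb).le
  rw [← Real.mul_rpow hb.le (inv_pos.2 hb).le, mul_inv_cancel₀ hb.ne', Real.one_rpow] at h1
  calc ∫⁻ ω, ‖V ω‖ₑ ∂P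
      ≤ ∫⁻ ω, ENNReal.ofReal b * ENNReal.ofReal (Real.exp (b⁻¹ * |V ω|)) ∂P := by
        refine lintegral_mono fun ω => ?_
        rw [← ofReal_norm, ← ENNReal.ofReal_mul hb.le]
        refine ENNReal.ofReal_le_ofReal ?_
        have := mul_le_mul_of_nonneg_left (Real.add_one_le_exp (b⁻¹ * |V ω|)) hb.le
        rw [mul_add, mul_inv_cancel_left₀ hb.ne'] at this
        rw [Real.norm_eq_abs]
        linarith
    _ = ENNReal.ofReal b * ∫⁻ ω, ENNReal.ofReal (Real.exp (b⁻¹ * |V ω|)) ∂P :=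
        lintegral_const_mul' _ _ ENNReal.ofReal_ne_top
    _ ≤ _ := by
        rw [ENNReal.ofReal_mul hb.le]
        gcongr

end Chaining

/-! ### Elementary estimates behind the explicit bound. -/

section Numerics

theorem sum_geom_weights (p : ℝ) (m : ℕ) :
    ∑ k ∈ Finset.range m, (1 - p) * p ^ k = 1 - p ^ m := by
  induction m with
  | zero => simp
  | succ m ih => rw [Finset.sum_range_succ, ih]; ring

theorem sum_succ_mul_geom_weights_le {p : ℝ} (hp : 0 < p) (hp1 : p < 1) (m : ℕ) :
    ∑ k ∈ Finset.range m, (1 - p) * p ^ k * (k + 1) ≤ 1 / (1 - p) := by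
  have h : (∑ k ∈ Finset.range m, (1 - p) * p ^ k * (k + 1)) * (1 - p) =
      1 - p ^ m - m * p ^ m * (1 - p) := by
    induction m with
    | zero => simp
    | succ m ih => rw [Finset.sum_range_succ, add_mul, ih]; push_cast; ring
  rw [le_div_iff₀ (by linarith), h]
  have h1 : 0 ≤ m * p ^ m * (1 - p) := mul_nonneg (by positivity) (by linarith)
  have h2 : 0 < p ^ m := by positivity
  linarith

/-- A rearrangement of p log p ≥ p - 1. It says p^(-1/(1-p)) ≤ e/p, the source of the factor e in
the final bound. -/
theorem neg_log_div_one_sub_le {p : ℝ} (hp : 0 < p) (hp1 : p < 1) :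
    1 / (1 - p) * -Real.log p ≤ 1 - Real.log p := by
  have h := Real.one_sub_inv_le_log_of_pos hp
  have h2 : p * (1 - p⁻¹) ≤ p * Real.log p := mul_le_mul_of_nonneg_left h hp.le
  rw [mul_sub, mul_inv_cancel₀ hp.ne'] at h2
  rw [one_div_mul_eq_div, div_le_iff₀ (by linarith)]
  nlinarith

/-- The product of the bounds of all the levels of the chaining argument, where level `k` has at
most `2 p ^ (-(k + 1) / α)` points and carries the weight `(1 - p) p ^ k`. -/
theorem prod_levels_le {ζ α p l A : ℝ} (hζ : 1 < ζ) (hα : 0 < α) (hp : 0 < p) (hp1 : p < 1)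
    (hl : 0 ≤ l) {b : ℕ → ℝ} {n : ℕ → ℝ} (hb : ∀ k, 0 ≤ b k) (hn0 : ∀ k, 0 ≤ n k)
    (hn : ∀ k : ℕ, n k ≤ 2 * p ^ (-((k + 1 : ℝ) / α))) (m : ℕ)
    (hA : ∑ k ∈ Finset.range m, (1 - p) * p ^ k * (b k / ((1 - p) * p ^ k)) ^ ζ ≤ A) :
    ∏ k ∈ Finset.range m, (2 * n k * Real.exp (b k ^ ζ * (l / ((1 - p) * p ^ k)) ^ ζ / ζ)) ^
        ((1 - p) * p ^ k) ≤
      2 * (2 * (Real.exp 1 / p) ^ (1 / α)) * Real.exp (A * l ^ ζ / ζ) := by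
  set w : ℕ → ℝ := fun k => (1 - p) * p ^ k with hw
  have hwpos : ∀ k, 0 < w k := fun k => mul_pos (by linarith) (by positivity)
  calc ∏ k ∈ Finset.range m, (2 * n k * Real.exp (b k ^ ζ * (l / w k) ^ ζ / ζ)) ^ w k
      ≤ ∏ k ∈ Finset.range m, Real.exp (w k * Real.log 4 + w k * (k + 1) * (-Real.log p / α) +
          w k * (b k / w k) ^ ζ * (l ^ ζ / ζ)) := by
        refine Finset.prod_le_prod (fun k _ => ?_) fun k _ => ?_
        · have := hn0 k
          positivity
        · have hE : Real.exp (w k * Real.log 4 + w k * (k + 1) * (-Real.log p / α) +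
              w k * (b k / w k) ^ ζ * (l ^ ζ / ζ)) =
              (4 * p ^ (-((k + 1 : ℝ) / α)) * Real.exp (b k ^ ζ * (l / w k) ^ ζ / ζ)) ^ w k := by
            have e4 : (4 : ℝ) = Real.exp (Real.log 4) := (Real.exp_log (by norm_num)).symm
            rw [Real.rpow_def_of_pos hp, Real.div_rpow (hb k) (hwpos k).le,
              Real.div_rpow hl (hwpos k).le]
            nth_rw 2 [e4]
            rw [← Real.exp_add, ← Real.exp_add, ← Real.exp_mul]
            congr 1
            ring
          rw [hE]
          have := hn0 k
          refine Real.rpow_le_rpow (by positivity) ?_ (hwpos k).le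
          exact mul_le_mul_of_nonneg_right (by linarith [hn k]) (Real.exp_pos _).le
    _ = Real.exp ((∑ k ∈ Finset.range m, w k) * Real.log 4 +
          (∑ k ∈ Finset.range m, w k * (k + 1)) * (-Real.log p / α) +
          (∑ k ∈ Finset.range m, w k * (b k / w k) ^ ζ) * (l ^ ζ / ζ)) := by
        rw [← Real.exp_sum, Finset.sum_add_distrib, Finset.sum_add_distrib, Finset.sum_mul,
          Finset.sum_mul, Finset.sum_mul]
    _ ≤ Real.exp (1 * Real.log 4 + (1 - Real.log p) / α + A * (l ^ ζ / ζ)) := by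
        -- The 4 is the 2 from absolute values times the 2 from the net sizes. As log 4 and -log p
        -- are nonnegative, upper bounds for the weight sums suffice.
        have h1 : ∑ k ∈ Finset.range m, w k ≤ 1 := by
          rw [hw, sum_geom_weights]
          linarith [pow_pos hp m]
        have h2 := sum_succ_mul_geom_weights_le hp hp1 m
        have h3 := neg_log_div_one_sub_le hp hp1
        have h4 : 0 ≤ -Real.log p := by linarith [Real.log_neg hp hp1]
        have h5 : (∑ k ∈ Finset.range m, w k * (k + 1)) * (-Real.log p / α) ≤
            (1 - Real.log p) / α := by
          rw [← mul_div_assoc]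
          gcongr
          exact (mul_le_mul_of_nonneg_right h2 h4).trans h3
        have h6 : 0 ≤ Real.log 4 := Real.log_nonneg (by norm_num)
        gcongr
    _ = _ := by
        rw [Real.exp_add, Real.exp_add, one_mul, Real.exp_log (by norm_num),
          Real.rpow_def_of_pos (show 0 < Real.exp 1 / p by positivity), Real.log_div (Real.exp_pos _).ne' hp.ne',
          Real.log_exp, mul_one_div, mul_div_assoc]
        ring

/-- The optimal exponential Chebyshev bound. -/
theorem exists_chernoff_parameter {ζ A δ : ℝ} (hζ : 1 < ζ) (hA : 0 < A) (hδ : 0 < δ) :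
    ∃ l : ℝ, 0 < l ∧
      A * l ^ ζ / ζ - l * δ = -((ζ - 1) / ζ * δ ^ (ζ / (ζ - 1)) / A ^ (1 / (ζ - 1))) := by
  have hz : ζ - 1 ≠ 0 := by linarith
  -- The stationary point of l ↦ A l^ζ/ζ - lδ, that is, A l^(ζ-1) = δ.
  refine ⟨(δ / A) ^ (1 / (ζ - 1)), by positivity, ?_⟩
  set l := (δ / A) ^ (1 / (ζ - 1)) with hl
  have hlpos : 0 < l := by positivity
  have h1 : l ^ (ζ - 1) = δ / A := by
    rw [hl, ← Real.rpow_mul (by positivity), one_div_mul_cancel hz, Real.rpow_one]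
  have h2 : l ^ ζ = δ / A * l := by
    rw [← h1, ← Real.rpow_add_one hlpos.ne']; congr 1; ring
  have h3 : δ ^ (ζ / (ζ - 1)) = δ ^ (1 / (ζ - 1)) * δ := by
    rw [← Real.rpow_add_one hδ.ne']; congr 1; field_simp; ring
  have h4 : l = δ ^ (1 / (ζ - 1)) / A ^ (1 / (ζ - 1)) := Real.div_rpow hδ.le hA.le _
  rw [h2, h3]
  have h5 : (ζ - 1) / ζ * (δ ^ (1 / (ζ - 1)) * δ) / A ^ (1 / (ζ - 1)) = (ζ - 1) / ζ * δ * l := by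
    rw [h4]; ring
  rw [h5]
  field_simp
  ring

/-- The variance proxy of the supremum in the chaining argument. -/
theorem levels_proxy_eq {ζ γ δ β : ℝ} (hγ : 0 < γ) (hδ : γ < δ) (hβ : 0 ≤ β) :
    (1 - γ / δ) * (γ / (1 - γ / δ)) ^ ζ + γ / δ * (β / (1 - γ / δ)) ^ ζ =
      δ ^ (ζ - 1) * (γ ^ ζ * (δ - γ) + β ^ ζ * γ) / (δ - γ) ^ ζ := by
  have hδ0 : 0 < δ := hγ.trans hδ
  have hd : 0 < δ - γ := by linarith
  have h1 : 1 - γ / δ = (δ - γ) / δ := by field_simp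
  have h2 : ∀ x : ℝ, 0 ≤ x → (x / ((δ - γ) / δ)) ^ ζ = x ^ ζ * (δ ^ (ζ - 1) * δ) / (δ - γ) ^ ζ := by
    intro x hx
    rw [← Real.rpow_add_one hδ0.ne', sub_add_cancel, div_div_eq_mul_div,
      Real.div_rpow (by positivity) hd.le, Real.mul_rpow hx hδ0.le]
  rw [h1, h2 γ hγ.le, h2 β hβ]
  field_simp

theorem exists_parameter_tailBound {ζ α γ δ β : ℝ} (hζ : 1 < ζ) (hγ : 0 < γ)
    (hδ : γ < δ) (hβ : 0 ≤ β) : ∃ l : ℝ, 0 < l ∧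
      2 * (2 * (Real.exp 1 / (γ / δ)) ^ (1 / α)) * Real.exp
        (((1 - γ / δ) * (γ / (1 - γ / δ)) ^ ζ + γ / δ * (β / (1 - γ / δ)) ^ ζ) * l ^ ζ / ζ) *
        Real.exp (-(l * δ)) = tailBound ζ α β γ δ := by
  have hδ0 : 0 < δ := hγ.trans hδ
  have hd : 0 < δ - γ := by linarith
  have hz : ζ - 1 ≠ 0 := by linarith
  rw [levels_proxy_eq hγ hδ hβ]
  set D := γ ^ ζ * (δ - γ) + β ^ ζ * γ with hD
  have hD0 : 0 < D := by
    have : 0 ≤ β ^ ζ := by positivity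
    positivity
  obtain ⟨l, hl, h⟩ := exists_chernoff_parameter hζ
    (show 0 < δ ^ (ζ - 1) * D / (δ - γ) ^ ζ by positivity) hδ0
  refine ⟨l, hl, ?_⟩
  have e1 : (δ ^ (ζ - 1) * D / (δ - γ) ^ ζ) ^ (1 / (ζ - 1)) =
      δ * D ^ (1 / (ζ - 1)) / (δ - γ) ^ (ζ / (ζ - 1)) := by
    rw [Real.div_rpow (by positivity) (by positivity), Real.mul_rpow (by positivity) hD0.le,
      ← Real.rpow_mul hδ0.le, ← Real.rpow_mul hd.le, mul_one_div_cancel hz, Real.rpow_one,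
      mul_one_div]
  have e2 : δ ^ (ζ / (ζ - 1)) = δ ^ (1 / (ζ - 1)) * δ := by
    rw [← Real.rpow_add_one hδ0.ne']; congr 1; field_simp; ring
  rw [e1, e2] at h
  have e3 : (ζ - 1) / ζ * (δ ^ (1 / (ζ - 1)) * δ) /
      (δ * D ^ (1 / (ζ - 1)) / (δ - γ) ^ (ζ / (ζ - 1))) =
      (ζ - 1) * δ ^ (1 / (ζ - 1)) * (δ - γ) ^ (ζ / (ζ - 1)) / (ζ * D ^ (1 / (ζ - 1))) := by
    field_simp
  rw [e3] at h
  unfold tailBound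
  rw [← hD, ← h, mul_assoc _ (Real.exp _) (Real.exp _), ← Real.exp_add, div_div_eq_mul_div,
    ← sub_eq_add_neg]
  ring

end Numerics

/-! ### The chaining argument. -/

section Supremum

variable {Ω : Type*} [MeasurableSpace Ω] {P : Measure Ω} {ζ : ℝ}

/-- Chaining: an exponential tail bound for the sum over the levels `k` of the maxima of families
`V k` of `φ`-sub-Gaussian variables, with standards decreasing geometrically in `k`. -/
theorem measure_exists_sum_gt_le [IsProbabilityMeasure P] {α γ δ β : ℝ} (hζ : 1 < ζ)
    (hα : 0 < α) (hγ : 0 < γ) (hδ : γ < δ) (hβ : 0 ≤ β) {S : ℕ → Finset ℝ}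
    (hS : ∀ k, (S k).Nonempty)
    (hcard : ∀ k : ℕ, ((S k).card : ℝ) ≤ 2 * (γ / δ) ^ (-((k + 1 : ℝ) / α)))
    {V : ℕ → ℝ → Ω → ℝ} (hV : ∀ k, ∀ s ∈ S k, Measurable (V k s))
    (hV0 : ∀ s ∈ S 0, ExpProxy ζ P (V 0 s) (γ ^ ζ))
    (hVs : ∀ k, ∀ s ∈ S (k + 1), ExpProxy ζ P (V (k + 1) s) ((β * (γ / δ) ^ (k + 1)) ^ ζ)) :
    P {ω | ∃ m, δ < ∑ k ∈ Finset.range m, (S k).sup' (hS k) fun s => |V k s ω|} ≤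
      ENNReal.ofReal (tailBound ζ α β γ δ) := by
  have hδ0 : 0 < δ := hγ.trans hδ
  set p := γ / δ with hp
  have hp0 : 0 < p := by positivity
  have hp1 : p < 1 := (div_lt_one hδ0).2 hδ
  set M : ℕ → Ω → ℝ := fun k ω => (S k).sup' (hS k) fun s => |V k s ω| with hM
  have hMm : ∀ k, Measurable (M k) := fun k => by
    have := Finset.measurable_sup' (hS k) (f := fun s ω => |V k s ω|) fun s hs => (hV k s hs).abs
    convert this using 1
    ext ω
    simp [hM, Finset.sup'_apply]
  have hM0 : ∀ k ω, 0 ≤ M k ω := fun k ω => by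
    obtain ⟨s, hs⟩ := hS k
    exact (abs_nonneg _).trans (Finset.le_sup' (fun s => |V k s ω|) hs)
  set b : ℕ → ℝ := fun k => if k = 0 then γ else β * p ^ k with hb
  have hb0 : ∀ k, 0 ≤ b k := fun k => by
    simp only [hb]; split_ifs <;> positivity
  have hVb : ∀ k, ∀ s ∈ S k, ExpProxy ζ P (V k s) (b k ^ ζ) := by
    rintro (_ | k) s hs
    · simpa [hb] using hV0 s hs
    · simpa [hb] using hVs k s hs
  set w : ℕ → ℝ := fun k => (1 - p) * p ^ k with hw
  have hwpos : ∀ k, 0 < w k := fun k => mul_pos (by linarith) (by positivity)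
  have hA : ∀ m, ∑ k ∈ Finset.range m, (1 - p) * p ^ k * (b k / ((1 - p) * p ^ k)) ^ ζ ≤
      (1 - p) * (γ / (1 - p)) ^ ζ + p * (β / (1 - p)) ^ ζ := by
    have h1p : 0 < 1 - p := by linarith
    rintro (_ | m)
    · simp only [Finset.range_zero, Finset.sum_empty]
      positivity
    · rw [Finset.sum_range_succ', add_comm]
      -- The weights decay at the same rate as the standards, so b/w is constant from level 1 on and
      -- the sum is geometric.
      have h1 : ∀ k : ℕ, (1 - p) * p ^ (k + 1) * (b (k + 1) / ((1 - p) * p ^ (k + 1))) ^ ζ =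
          (1 - p) * p ^ k * (p * (β / (1 - p)) ^ ζ) := fun k => by
        have : b (k + 1) / ((1 - p) * p ^ (k + 1)) = β / (1 - p) := by
          simp only [hb, Nat.succ_ne_zero, if_false]
          field_simp
        rw [this]
        ring
      simp only [h1]
      rw [← Finset.sum_mul, sum_geom_weights]
      simp only [hb, if_true, pow_zero, mul_one]
      have h2 : 0 ≤ p ^ m := by positivity
      exact add_le_add le_rfl (mul_le_of_le_one_left (by positivity) (by linarith))
  obtain ⟨l, hl, hlT⟩ := exists_parameter_tailBound (α := α) hζ hγ hδ hβ
  have hset : {ω | ∃ m, δ < ∑ k ∈ Finset.range m, M k ω} =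
      ⋃ m, {ω | δ < ∑ k ∈ Finset.range m, M k ω} := by ext; simp
  rw [hset, Monotone.measure_iUnion]
  swap
  · intro m n hmn ω (hω : δ < _)
    exact hω.trans_le (Finset.sum_le_sum_of_subset_of_nonneg
      (Finset.range_mono hmn) fun k _ _ => hM0 k ω)
  refine iSup_le fun m => ?_
  have hint : ∫⁻ ω, ENNReal.ofReal (Real.exp (l * ∑ k ∈ Finset.range m, M k ω)) ∂P ≤
      ENNReal.ofReal (2 * (2 * (Real.exp 1 / p) ^ (1 / α)) * Real.exp
        (((1 - p) * (γ / (1 - p)) ^ ζ + p * (β / (1 - p)) ^ ζ) * l ^ ζ / ζ)) := by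
    refine (lintegral_exp_sum_le hMm hwpos m ?_ l).trans ?_
    · rw [hw, sum_geom_weights]
      linarith [pow_pos hp0 m]
    refine le_trans ?_ (ENNReal.ofReal_le_ofReal (prod_levels_le hζ hα hp0 hp1 hl.le hb0
      (fun k => Nat.cast_nonneg (S k).card) hcard m (hA m)))
    rw [ENNReal.ofReal_prod_of_nonneg fun k _ => by positivity]
    refine Finset.prod_le_prod' fun k _ => ?_
    rw [← ENNReal.ofReal_rpow_of_nonneg (by positivity) (hwpos k).le]
    refine ENNReal.rpow_le_rpow ?_ (hwpos k).le
    exact ExpProxy.lintegral_exp_sup'_abs_le (hS k) (hV k) (hVb k)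
      (div_nonneg hl.le (hwpos k).le)
  calc P {ω | δ < ∑ k ∈ Finset.range m, M k ω}
      = ∫⁻ _ in {ω | δ < ∑ k ∈ Finset.range m, M k ω}, 1 ∂P := by simp
    _ ≤ ∫⁻ ω in {ω | δ < ∑ k ∈ Finset.range m, M k ω},
          ENNReal.ofReal (Real.exp (l * ∑ k ∈ Finset.range m, M k ω)) *
            ENNReal.ofReal (Real.exp (-(l * δ))) ∂P := by
        refine setLIntegral_mono' (measurableSet_lt measurable_const
          (Finset.measurable_sum _ fun k _ => hMm k)) fun ω (hω : δ < _) => ?_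
        rw [← ENNReal.ofReal_mul (Real.exp_pos _).le, ← Real.exp_add]
        refine ENNReal.one_le_ofReal.2 (Real.one_le_exp ?_)
        have := mul_le_mul_of_nonneg_left hω.le hl.le
        linarith
    _ ≤ ∫⁻ ω, ENNReal.ofReal (Real.exp (l * ∑ k ∈ Finset.range m, M k ω)) *
            ENNReal.ofReal (Real.exp (-(l * δ))) ∂P := setLIntegral_le_lintegral _ _
    _ ≤ _ := by
        rw [lintegral_mul_const' _ _ ENNReal.ofReal_ne_top, ← hlT,
          ENNReal.ofReal_mul (q := Real.exp _) (by positivity)]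
        gcongr

/-- Outside of an event whose probability is at most `tailBound`, every value of a
`φ`-sub-Gaussian process with a Hölder modulus is at most `δ`, almost surely. -/
theorem exists_event_abs_le [IsProbabilityMeasure P] {T α K γ δ : ℝ} (hT : 0 < T) (hζ : 1 < ζ)
    (hα : 0 < α) (hK : 0 ≤ K) (hγ : 0 < γ) (hδ : γ < δ) {Y : ℝ → Ω → ℝ}
    (hY : ∀ t ∈ Set.Icc 0 T, IsSub (powPhi ζ) P (Y t))
    (hmod : HasModulus (powPhi ζ) P (Set.Icc 0 T) Y fun h => K * h ^ α)
    (hτ : ∀ t ∈ Set.Icc 0 T, tau (powPhi ζ) P (Y t) ≤ γ) :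
    ∃ B : Set Ω, P B ≤ ENNReal.ofReal (tailBound ζ α (K * (T / 2) ^ α) γ δ) ∧
      ∀ t ∈ Set.Icc 0 T, ∀ᵐ ω ∂P, ω ∉ B → |Y t ω| ≤ δ := by
  have hδ0 : 0 < δ := hγ.trans hδ
  set p := γ / δ with hp
  have hp0 : 0 < p := by positivity
  have hp1 : p < 1 := (div_lt_one hδ0).2 hδ
  set β := K * (T / 2) ^ α with hβ
  have hβ0 : 0 ≤ β := by positivity
  -- Chosen so that a net of radius T/(2r_k) has increments of standard at most βp^(k+1). The
  -- exponent starts at 1/α, and r_k ≥ 1 for every p < 1.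
  set r : ℕ → ℝ := fun k => p ^ (-((k + 1 : ℝ) / α)) with hr
  have hr0 : ∀ k, 0 < r k := fun k => by positivity
  have hr1 : ∀ k, 1 ≤ r k := fun k =>
    Real.one_le_rpow_of_pos_of_le_one_of_nonpos hp0 hp1.le (neg_nonpos.2 (by positivity))
  have hε : ∀ k, K * (T / (2 * r k)) ^ α = β * p ^ (k + 1) := fun k => by
    have h1 : T / (2 * r k) = T / 2 * p ^ ((k + 1 : ℝ) / α) := by
      simp only [hr]
      rw [Real.rpow_neg hp0.le]
      field_simp
    rw [h1, Real.mul_rpow (by positivity) (by positivity), ← Real.rpow_mul hp0.le,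
      div_mul_cancel₀ _ hα.ne', ← mul_assoc, ← hβ]
    norm_cast
  choose S hSsub hScard hSnet using fun k => exists_grid hT (hr1 k)
  have hS : ∀ k, (S k).Nonempty := fun k => by
    obtain ⟨u, hu, -⟩ := hSnet k 0 ⟨le_rfl, hT.le⟩
    exact ⟨u, hu⟩
  -- With the membership inside the conclusion, `near` becomes a total function that lands in the
  -- net even for t outside the interval.
  have hnet : ∀ k t, ∃ u ∈ S k, t ∈ Set.Icc 0 T → |t - u| ≤ T / (2 * r k) := fun k t => by
    by_cases ht : t ∈ Set.Icc 0 T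
    · obtain ⟨u, hu, h⟩ := hSnet k t ht
      exact ⟨u, hu, fun _ => h⟩
    · obtain ⟨u, hu⟩ := hS k
      exact ⟨u, hu, fun h => absurd h ht⟩
  choose near hnear hnear_le using hnet
  have hincr : ∀ k, ∀ t ∈ Set.Icc 0 T,
      ExpProxy ζ P (fun ω => Y t ω - Y (near k t) ω) ((β * p ^ (k + 1)) ^ ζ) := fun k t ht => by
    have hn := hSsub k _ (hnear k t)
    refine ((hY t ht).sub hζ (hY _ hn)).expProxy_of_tau_le hζ ?_
    rw [← hε]
    exact hmod _ (div_pos hT (mul_pos two_pos (hr0 k))) t ht _ hn (hnear_le k t ht)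
  set V : ℕ → ℝ → Ω → ℝ := fun k s ω =>
    match k with
    | 0 => Y s ω
    | k + 1 => Y s ω - Y (near k s) ω with hVdef
  have hVm : ∀ k, ∀ s ∈ S k, Measurable (V k s) := by
    rintro (_ | k) s hs
    · exact (hY s (hSsub _ s hs)).1
    · exact (hY s (hSsub _ s hs)).1.sub (hY _ (hSsub k _ (hnear k s))).1
  refine ⟨_, measure_exists_sum_gt_le hζ hα hγ hδ hβ0 hS hScard hVm
    (fun s hs => (hY s (hSsub _ s hs)).expProxy_of_tau_le hζ (hτ s (hSsub _ s hs)))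
    (fun k s hs => hincr k s (hSsub _ s hs)), fun t ht => ?_⟩
  set M : ℕ → Ω → ℝ := fun k ω => (S k).sup' (hS k) fun s => |V k s ω|
  have hchain : ∀ k, ∀ s ∈ S k, ∀ ω, |Y s ω| ≤ ∑ j ∈ Finset.range (k + 1), M j ω := by
    intro k
    induction k with
    | zero =>
      intro s hs ω
      simpa using Finset.le_sup' (fun s => |V 0 s ω|) hs
    | succ k ih =>
      intro s hs ω
      rw [Finset.sum_range_succ]
      have h1 := ih _ (hnear k s) ω
      have h2 : |V (k + 1) s ω| ≤ M (k + 1) ω := Finset.le_sup' (fun s => |V (k + 1) s ω|) hs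
      have h3 : |Y s ω| ≤ |Y (near k s) ω| + |Y s ω - Y (near k s) ω| := by
        have := abs_add_le (Y (near k s) ω) (Y s ω - Y (near k s) ω)
        rwa [add_sub_cancel] at this
      exact h3.trans (add_le_add h1 h2)
  have hlim : Tendsto (fun k => eLpNorm (fun ω => Y t ω - Y (near k t) ω) 1 P) atTop (𝓝 0) := by
    -- β may vanish; β + 1 keeps the standard positive.
    have hbound : ∀ k, eLpNorm (fun ω => Y t ω - Y (near k t) ω) 1 P ≤
        ENNReal.ofReal ((β + 1) * p ^ (k + 1) * (2 * Real.exp (1 / ζ))) := fun k => by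
      refine ExpProxy.eLpNorm_one_le ((hY t ht).1.sub (hY _ (hSsub k _ (hnear k t))).1)
        (by positivity) ((hincr k t ht).mono hζ ?_)
      have : β ≤ β + 1 := by linarith
      gcongr
    refine tendsto_of_tendsto_of_tendsto_of_le_of_le tendsto_const_nhds ?_
      (fun _ => zero_le) hbound
    have h1 := (tendsto_pow_atTop_nhds_zero_of_lt_one hp0.le hp1).comp (tendsto_add_atTop_nat 1)
    have h2 := ENNReal.tendsto_ofReal ((h1.const_mul (β + 1)).mul_const (2 * Real.exp (1 / ζ)))
    simpa using h2
  obtain ⟨ns, -, hns⟩ := exists_seq_tendsto_ae_of_eLpNorm_sub one_ne_zero (hY t ht).1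
    (fun k => (hY _ (hSsub k _ (hnear k t))).1) hlim
  filter_upwards [hns] with ω hω hωB
  refine le_of_tendsto hω.abs (Eventually.of_forall fun i => ?_)
  by_contra! hcon
  exact hωB ⟨ns i + 1, hcon.trans_le (hchain _ _ (hnear _ _) ω)⟩

end Supremum

/-! ### From a dense set of times to the whole interval. -/

/-- A bound for `x - g`, `g` continuous, on `S` holds at each `t` such that `(t, x t)` is in the
closure of the graph of `x` over `S`. -/
theorem abs_le_of_mem_closure_graph {S B : Set ℝ} (hSB : S ⊆ B) {x g : ℝ → ℝ} {t δ : ℝ}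
    (hg : ContinuousWithinAt g B t)
    (hcl : (t, x t) ∈ closure ((fun s => (s, x s)) '' S))
    (h : ∀ s ∈ S, |x s - g s| ≤ δ) : |x t - g t| ≤ δ := by
  obtain ⟨y, hy, hlim⟩ := mem_closure_iff_seq_limit.1 hcl
  choose s hs hsy using hy
  have hs1 : Tendsto s atTop (𝓝 t) := by
    refine ((continuous_fst.tendsto _).comp hlim).congr fun n => ?_
    simp [← hsy n]
  have hs2 : Tendsto (fun n => x (s n)) atTop (𝓝 (x t)) := by
    refine ((continuous_snd.tendsto _).comp hlim).congr fun n => ?_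
    simp [← hsy n]
  have hs3 : Tendsto (fun n => g (s n)) atTop (𝓝 (g t)) :=
    hg.tendsto.comp (tendsto_nhdsWithin_iff.2 ⟨hs1, Eventually.of_forall fun n => hSB (hs n)⟩)
  exact le_of_tendsto (hs2.sub hs3).abs (Eventually.of_forall fun n => h _ (hs n))

theorem continuousOn_of_abs_sub_le {B : Set ℝ} {g : ℝ → ℝ} {c α : ℝ} (hα : 0 < α)
    (h : ∀ t ∈ B, ∀ s ∈ B, |g t - g s| ≤ c * |t - s| ^ α) : ContinuousOn g B := by
  intro t ht
  rw [ContinuousWithinAt, tendsto_iff_dist_tendsto_zero]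
  have h0 : Tendsto (fun s => c * |s - t| ^ α) (𝓝[B] t) (𝓝 0) := by
    have : Continuous fun s : ℝ => c * |s - t| ^ α :=
      continuous_const.mul ((continuous_abs.comp (continuous_id.sub continuous_const)).rpow_const
        fun _ => Or.inr hα.le)
    have h1 := this.tendsto t
    simp only [sub_self, abs_zero, Real.zero_rpow hα.ne', mul_zero] at h1
    exact h1.mono_left nhdsWithin_le_nhds
  refine squeeze_zero' (Eventually.of_forall fun _ => dist_nonneg) ?_ h0
  filter_upwards [self_mem_nhdsWithin] with s hs
  rw [Real.dist_eq]
  exact h s hs t ht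

/-! ### The error of the model. -/

section ModelError

variable {Ω : Type*} [MeasurableSpace Ω] {P : Measure Ω} {ζ : ℝ}

theorem expProxy_error [IsProbabilityMeasure P] (hζ : 1 < ζ) {B : Set ℝ} {X : ℝ → Ω → ℝ}
    {ξ : ℕ → Ω → ℝ} {a : ℕ → ℝ → ℝ} (hX : ∀ t ∈ B, IsSub (powPhi ζ) P (X t))
    (hξ : ∀ k, IsSub (powPhi ζ) P (ξ k)) (hindep : iIndepFun ξ P)
    (hser : IsSeriesExpansion P B X ξ a) (â : ℕ → ℝ → ℝ) (N : ℕ) {t : ℝ} (ht : t ∈ B) :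
    ExpProxy ζ P (fun ω => X t ω - partialSum ξ â N t ω) (tau (powPhi ζ) P (X t) ^ ζ +
      ∑ k ∈ Finset.range N, (tau (powPhi ζ) P (ξ k) * |a k t - â k t|) ^ ζ) := by
  have := ExpProxy.sub_head hζ hξ hindep (hX t ht).1 (fun k => a k t) (fun k => a k t - â k t) N
    (hser t ht) ((hX t ht).expProxy_tau hζ)
  simpa only [sub_sub_cancel, partialSum] using this

/-- An increment of X is itself a mean-square series, with coefficients a_k(t) - a_k(s), so its head
can be replaced as for X(t). -/
theorem expProxy_error_sub [IsProbabilityMeasure P] (hζ : 1 < ζ) {B : Set ℝ} {X : ℝ → Ω → ℝ}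
    {ξ : ℕ → Ω → ℝ} {a : ℕ → ℝ → ℝ} (hX : ∀ t ∈ B, IsSub (powPhi ζ) P (X t))
    (hξ : ∀ k, IsSub (powPhi ζ) P (ξ k)) (hindep : iIndepFun ξ P)
    (hser : IsSeriesExpansion P B X ξ a) (â : ℕ → ℝ → ℝ) (N : ℕ) {t s : ℝ} (ht : t ∈ B)
    (hs : s ∈ B) :
    ExpProxy ζ P (fun ω => (X t ω - partialSum ξ â N t ω) - (X s ω - partialSum ξ â N s ω))
      (tau (powPhi ζ) P (fun ω => X t ω - X s ω) ^ ζ + ∑ k ∈ Finset.range N,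
        (tau (powPhi ζ) P (ξ k) * |(a k t - â k t) - (a k s - â k s)|) ^ ζ) := by
  have hsub := (hX t ht).sub hζ (hX s hs)
  have hm := fun (b : ℕ → ℝ → ℝ) n r => measurable_partialSum (fun k => (hξ k).1) b n r
  have hlim : Tendsto (fun n => eLpNorm (fun ω => (X t ω - X s ω) -
      ∑ k ∈ Finset.range n, ξ k ω * (a k t - a k s)) 2 P) atTop (𝓝 0) := by
    have h0 := (hser t ht).add (hser s hs)
    rw [add_zero] at h0
    refine tendsto_of_tendsto_of_tendsto_of_le_of_le tendsto_const_nhds h0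
      (fun _ => zero_le) fun n => ?_
    refine le_trans (le_of_eq ?_) (eLpNorm_sub_le
      ((hX t ht).1.sub (hm a n t)).aestronglyMeasurable
      ((hX s hs).1.sub (hm a n s)).aestronglyMeasurable one_le_two)
    congr 1
    ext ω
    simp only [partialSum, Pi.sub_apply, mul_sub, Finset.sum_sub_distrib]
    ring
  have := ExpProxy.sub_head hζ hξ hindep hsub.1 (fun k => a k t - a k s)
    (fun k => (a k t - â k t) - (a k s - â k s)) N hlim (hsub.expProxy_tau hζ)
  convert this using 2 with ω
  have h1 : ∀ k, a k t - a k s - (a k t - â k t - (a k s - â k s)) = â k t - â k s := fun k => by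
    ring
  simp only [h1, partialSum, mul_sub, Finset.sum_sub_distrib]
  ring

/-- The error as a series: the coefficients are `a_k - â_k` for `k < N` and `a_k` afterwards. -/
theorem expProxy_error_of_sum_le [IsProbabilityMeasure P] (hζ : 1 < ζ) {B : Set ℝ}
    {X : ℝ → Ω → ℝ} {ξ : ℕ → Ω → ℝ} {a : ℕ → ℝ → ℝ} (hX : ∀ t ∈ B, IsSub (powPhi ζ) P (X t))
    (hξ : ∀ k, IsSub (powPhi ζ) P (ξ k)) (hindep : iIndepFun ξ P)
    (hser : IsSeriesExpansion P B X ξ a) (â : ℕ → ℝ → ℝ) (N : ℕ) {t : ℝ} (ht : t ∈ B) {v : ℝ}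
    (hv : ∀ n, ∑ k ∈ Finset.range N, (tau (powPhi ζ) P (ξ k) * |a k t - â k t|) ^ ζ +
      ∑ k ∈ Finset.range n, (tau (powPhi ζ) P (ξ (N + k)) * |a (N + k) t|) ^ ζ ≤ v) :
    ExpProxy ζ P (fun ω => X t ω - partialSum ξ â N t ω) v := by
  set c : ℕ → ℝ := fun k => if k < N then a k t - â k t else a k t with hc
  have hlt : ∀ k ∈ Finset.range N, c k = a k t - â k t := fun k hk => by
    simp [hc, Finset.mem_range.1 hk]
  refine expProxy_series hζ hξ hindep
    ((hX t ht).1.sub (measurable_partialSum (fun k => (hξ k).1) â N t)) c ?_ fun n => ?_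
  · refine (hser t ht).congr' ?_
    filter_upwards [eventually_ge_atTop N] with n hn
    congr 1
    ext ω
    obtain ⟨j, rfl⟩ := Nat.exists_eq_add_of_le hn
    have h1 : ∑ k ∈ Finset.range N, ξ k ω * c k =
        ∑ k ∈ Finset.range N, ξ k ω * a k t - ∑ k ∈ Finset.range N, ξ k ω * â k t := by
      rw [← Finset.sum_sub_distrib]
      exact Finset.sum_congr rfl fun k hk => by rw [hlt k hk, mul_sub]
    simp only [partialSum, Pi.sub_apply]
    rw [Finset.sum_range_add, Finset.sum_range_add (fun k => ξ k ω * c k), h1]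
    simp only [hc, Nat.not_lt.2 (Nat.le_add_right N _), if_false]
    ring
  · calc ∑ k ∈ Finset.range n, (tau (powPhi ζ) P (ξ k) * |c k|) ^ ζ
        ≤ ∑ k ∈ Finset.range (N + n), (tau (powPhi ζ) P (ξ k) * |c k|) ^ ζ :=
          Finset.sum_le_sum_of_subset_of_nonneg (Finset.range_mono (Nat.le_add_left _ _))
            fun k _ _ => Real.rpow_nonneg (mul_nonneg (tau_nonneg _ _ _) (abs_nonneg _)) _
      _ = ∑ k ∈ Finset.range N, (tau (powPhi ζ) P (ξ k) * |a k t - â k t|) ^ ζ +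
            ∑ k ∈ Finset.range n, (tau (powPhi ζ) P (ξ (N + k)) * |a (N + k) t|) ^ ζ := by
          rw [Finset.sum_range_add]
          congr 1
          · exact Finset.sum_congr rfl fun k hk => by rw [hlt k hk]
          · simp only [hc, Nat.not_lt.2 (Nat.le_add_right N _), if_false]
      _ ≤ v := hv n

theorem rpow_le_of_tau_le {x : Ω → ℝ} {c d : ℝ} (hζ : 1 < ζ) (hcd : |c| ≤ d) :
    (tau (powPhi ζ) P x * |c|) ^ ζ ≤ (tau (powPhi ζ) P x * d) ^ ζ :=
  Real.rpow_le_rpow (mul_nonneg (tau_nonneg _ _ _) (abs_nonneg _))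
    (mul_le_mul_of_nonneg_left hcd (tau_nonneg _ _ _)) (by linarith)

/-- Every proxy in the increment carries the common factor (h^α)^ζ; taking the ζ-th root returns
h^α. -/
theorem hasModulus_error [IsProbabilityMeasure P] {α C : ℝ} (hζ : 1 < ζ) (hα : 0 < α)
    (hC : 0 ≤ C) {B : Set ℝ} {X : ℝ → Ω → ℝ} {ξ : ℕ → Ω → ℝ} {a â : ℕ → ℝ → ℝ} {N : ℕ}
    {Cδ : ℕ → ℝ} (hX : ∀ t ∈ B, IsSub (powPhi ζ) P (X t))
    (hξ : ∀ k, IsSub (powPhi ζ) P (ξ k)) (hindep : iIndepFun ξ P)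
    (hser : IsSeriesExpansion P B X ξ a)
    (hmod : HasModulus (powPhi ζ) P B X fun h => C * h ^ α) (hCδ : ∀ k < N, 0 ≤ Cδ k)
    (hδ : ∀ k < N, ∀ t ∈ B, ∀ s ∈ B,
      |(a k t - â k t) - (a k s - â k s)| ≤ Cδ k * |t - s| ^ α) :
    HasModulus (powPhi ζ) P B (fun t ω => X t ω - partialSum ξ â N t ω) fun h =>
      (C ^ ζ + ∑ k ∈ Finset.range N, (tau (powPhi ζ) P (ξ k) * Cδ k) ^ ζ) ^ (1 / ζ) * h ^ α := by
  intro h hh t ht s hs hts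
  have hhα : 0 ≤ h ^ α := by positivity
  have hnn : ∀ k ∈ Finset.range N, 0 ≤ (tau (powPhi ζ) P (ξ k) * Cδ k) ^ ζ := fun k hk =>
    Real.rpow_nonneg (mul_nonneg (tau_nonneg _ _ _) (hCδ k (Finset.mem_range.1 hk))) _
  have hD : 0 ≤ C ^ ζ + ∑ k ∈ Finset.range N, (tau (powPhi ζ) P (ξ k) * Cδ k) ^ ζ :=
    add_nonneg (by positivity) (Finset.sum_nonneg hnn)
  have key := (expProxy_error_sub hζ hX hξ hindep hser â N ht hs).mono hζ
    (w := (C ^ ζ + ∑ k ∈ Finset.range N, (tau (powPhi ζ) P (ξ k) * Cδ k) ^ ζ) * (h ^ α) ^ ζ) (by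
      rw [add_mul, Finset.sum_mul, ← Real.mul_rpow hC hhα]
      refine add_le_add (Real.rpow_le_rpow (tau_nonneg _ _ _) (hmod h hh t ht s hs hts)
        (by linarith)) (Finset.sum_le_sum fun k hk => ?_)
      have hk' := Finset.mem_range.1 hk
      rw [← Real.mul_rpow (mul_nonneg (tau_nonneg _ _ _) (hCδ k hk')) hhα, mul_assoc]
      refine rpow_le_of_tau_le hζ ((hδ k hk' t ht s hs).trans ?_)
      exact mul_le_mul_of_nonneg_left
        (Real.rpow_le_rpow (abs_nonneg _) hts hα.le) (hCδ k hk'))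
  refine (key.tau_le hζ (mul_nonneg hD (by positivity))).trans (le_of_eq ?_)
  rw [Real.mul_rpow hD (by positivity), ← Real.rpow_mul hhα, mul_one_div_cancel (by linarith),
    Real.rpow_one]

/-- A power modulus on a bounded interval makes the standards bounded. -/
theorem bddAbove_tau {T α K : ℝ} (hT : 0 < T) (hζ : 1 < ζ) {Y : ℝ → Ω → ℝ}
    (hY : ∀ t ∈ Set.Icc 0 T, IsSub (powPhi ζ) P (Y t))
    (hmod : HasModulus (powPhi ζ) P (Set.Icc 0 T) Y fun h => K * h ^ α) :
    BddAbove ((fun u => tau (powPhi ζ) P (Y u)) '' Set.Icc 0 T) := by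
  have h0 : (0 : ℝ) ∈ Set.Icc 0 T := ⟨le_rfl, hT.le⟩
  -- From Y(t) = Y(0) + (Y(t) - Y(0)), with the modulus taken at h = T.
  refine ⟨(2 ^ ζ * max (tau (powPhi ζ) P (Y 0) ^ ζ) ((K * T ^ α) ^ ζ)) ^ (1 / ζ), ?_⟩
  rintro _ ⟨t, ht, rfl⟩
  have h1 := ((hY t ht).sub hζ (hY 0 h0)).expProxy_of_tau_le hζ
    (hmod T hT t ht 0 h0 (by rw [sub_zero, abs_of_nonneg ht.1]; exact ht.2))
  have h2 := ((hY 0 h0).expProxy_tau hζ).add hζ (hY 0 h0).1 h1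
  simp only [add_sub_cancel] at h2
  exact h2.tau_le hζ (mul_nonneg (by positivity)
    (le_max_of_le_left (Real.rpow_nonneg (tau_nonneg _ _ _) _)))

theorem tau_error_rpow_le [IsProbabilityMeasure P] (hζ : 1 < ζ) {B : Set ℝ}
    {X : ℝ → Ω → ℝ} {ξ : ℕ → Ω → ℝ} {a : ℕ → ℝ → ℝ} (hX : ∀ t ∈ B, IsSub (powPhi ζ) P (X t))
    (hξ : ∀ k, IsSub (powPhi ζ) P (ξ k)) (hindep : iIndepFun ξ P)
    (hser : IsSeriesExpansion P B X ξ a) (â : ℕ → ℝ → ℝ) (N : ℕ) {t : ℝ} (ht : t ∈ B) {v : ℝ}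
    (hv0 : 0 ≤ v)
    (hv : (∑ k ∈ Finset.range N, ENNReal.ofReal (tau (powPhi ζ) P (ξ k) ^ ζ) *
        ⨆ u ∈ B, ENNReal.ofReal (|a k u - â k u| ^ ζ)) +
      (∑' k, ENNReal.ofReal (tau (powPhi ζ) P (ξ (N + k)) ^ ζ) *
        ⨆ u ∈ B, ENNReal.ofReal (|a (N + k) u| ^ ζ)) ≤ ENNReal.ofReal v) :
    tau (powPhi ζ) P (fun ω => X t ω - partialSum ξ â N t ω) ≤ v ^ (1 / ζ) := by
  refine (expProxy_error_of_sum_le hζ hX hξ hindep hser â N ht fun n => ?_).tau_le hζ hv0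
  have hterm : ∀ (x : Ω → ℝ) (g : ℝ → ℝ), ENNReal.ofReal ((tau (powPhi ζ) P x * |g t|) ^ ζ) ≤
      ENNReal.ofReal (tau (powPhi ζ) P x ^ ζ) * ⨆ u ∈ B, ENNReal.ofReal (|g u| ^ ζ) :=
    fun x g => by
      rw [Real.mul_rpow (tau_nonneg _ _ _) (abs_nonneg _),
        ENNReal.ofReal_mul (Real.rpow_nonneg (tau_nonneg _ _ _) _)]
      gcongr
      exact le_iSup₂ (f := fun u (_ : u ∈ B) => ENNReal.ofReal (|g u| ^ ζ)) t ht
  have hnn : ∀ (x : Ω → ℝ) (c : ℝ), 0 ≤ (tau (powPhi ζ) P x * |c|) ^ ζ := fun x c =>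
    Real.rpow_nonneg (mul_nonneg (tau_nonneg _ _ _) (abs_nonneg _)) _
  rw [← ENNReal.ofReal_le_ofReal_iff hv0, ENNReal.ofReal_add
    (Finset.sum_nonneg fun _ _ => hnn _ _) (Finset.sum_nonneg fun _ _ => hnn _ _),
    ENNReal.ofReal_sum_of_nonneg fun _ _ => hnn _ _,
    ENNReal.ofReal_sum_of_nonneg fun _ _ => hnn _ _]
  refine le_trans (add_le_add (Finset.sum_le_sum fun k _ => ?_)
    ((Finset.sum_le_sum fun k _ => ?_).trans (ENNReal.sum_le_tsum _))) hv
  · exact hterm (ξ k) fun u => a k u - â k u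
  · exact hterm (ξ (N + k)) (a (N + k))

/-- Approximation in `C([0, T])` of a separable process by a process with continuous paths. -/
theorem approximates_of_le_tailBound [IsProbabilityMeasure P] {T α K γ δ ν : ℝ} (hT : 0 < T)
    (hζ : 1 < ζ) (hα : 0 < α) (hK : 0 ≤ K) (hγ : 0 < γ) (hδ : γ < δ) {X M : ℝ → Ω → ℝ}
    (hsep : IsSeparableProcess P (Set.Icc 0 T) X)
    (hM : ∀ ω, ContinuousOn (fun t => M t ω) (Set.Icc 0 T))
    (hsub : ∀ t ∈ Set.Icc 0 T, IsSub (powPhi ζ) P fun ω => X t ω - M t ω)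
    (hmod : HasModulus (powPhi ζ) P (Set.Icc 0 T) (fun t ω => X t ω - M t ω) fun h => K * h ^ α)
    (hτ : ∀ t ∈ Set.Icc 0 T, tau (powPhi ζ) P (fun ω => X t ω - M t ω) ≤ γ)
    (hν : tailBound ζ α (K * (T / 2) ^ α) γ δ ≤ ν) :
    Approximates P (Set.Icc 0 T) X M ν δ := by
  obtain ⟨B, hB, hBle⟩ := exists_event_abs_le hT hζ hα hK hγ hδ hsub hmod hτ
  obtain ⟨S, hST, hSc, -, hScl⟩ := hsep
  refine le_trans (measure_mono_ae ?_) (hB.trans (ENNReal.ofReal_le_ofReal hν))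
  -- Countability of S merges the null sets belonging to the individual times.
  have hSall : ∀ᵐ ω ∂P, ∀ s ∈ S, ω ∉ B → |X s ω - M s ω| ≤ δ :=
    (ae_ball_iff hSc).2 fun s hs => hBle s (hST hs)
  filter_upwards [hSall, hScl] with ω hω hcl
  intro (hlt : (δ : EReal) < _)
  by_contra hωB
  refine hlt.not_ge (iSup₂_le fun t ht => EReal.coe_le_coe_iff.2 ?_)
  exact abs_le_of_mem_closure_graph hST (hM ω t ht) (hcl t ht) fun s hs => hω s hs hωB

end ModelError

end PhiSub

theorem theorem12 {Ω : Type*} [MeasurableSpace Ω] (P : Measure Ω) [IsProbabilityMeasure P]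
    (T ζ α C : ℝ) (hT : 0 < T) (hζ : 1 < ζ) (hζ' : ζ ≤ 2) (hα : 0 < α) (hα' : α < 1) (hC : 0 ≤ C)
    (X : ℝ → Ω → ℝ) (ξ : ℕ → Ω → ℝ) (a â : ℕ → ℝ → ℝ) (N : ℕ) (Cδ Ca : ℕ → ℝ)
    -- `X` is a separable process from `Sub_φ(Ω)`
    (hX : ∀ t ∈ Set.Icc 0 T, PhiSub.IsSub (PhiSub.powPhi ζ) P (X t))
    (hsep : PhiSub.IsSeparableProcess P (Set.Icc 0 T) X)
    -- it is a series with independent terms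
    (hξ : ∀ k, PhiSub.IsSub (PhiSub.powPhi ζ) P (ξ k))
    (hindep : iIndepFun ξ P)
    (hser : PhiSub.IsSeriesExpansion P (Set.Icc 0 T) X ξ a)
    -- the increments of `X` have the modulus `σ(h) = C h^α`
    (hmod : PhiSub.HasModulus (PhiSub.powPhi ζ) P (Set.Icc 0 T) X (fun h => C * h ^ α))
    -- Hölder conditions on `δ_k = a_k - â_k` and on `a_k`
    (hCδ : ∀ k < N, 0 ≤ Cδ k)
    (hδ : ∀ k < N, ∀ t ∈ Set.Icc 0 T, ∀ s ∈ Set.Icc 0 T,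
      |(a k t - â k t) - (a k s - â k s)| ≤ Cδ k * |t - s| ^ α)
    (ha : ∀ k, ∀ t ∈ Set.Icc 0 T, ∀ s ∈ Set.Icc 0 T, |a k t - a k s| ≤ Ca k * |t - s| ^ α)
    -- the error `Δ_N = X - X_N` of the model `X_N = ∑_{k < N} ξ_k â_k`
    (Δ : ℝ → Ω → ℝ) (hΔ : ∀ t ω, Δ t ω = X t ω - PhiSub.partialSum ξ â N t ω)
    -- `γ_N = sup_u τ_φ(Δ_N(u))`
    (γN : ℝ) (hγN : γN = PhiSub.supTau (PhiSub.powPhi ζ) P (Set.Icc 0 T) Δ) :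
    -- the error belongs to `Sub_φ(Ω)` and inherits a power modulus
    (∀ t ∈ Set.Icc 0 T, PhiSub.IsSub (PhiSub.powPhi ζ) P (Δ t)) ∧
    PhiSub.HasModulus (PhiSub.powPhi ζ) P (Set.Icc 0 T) Δ
      (fun h => (C ^ ζ + ∑ k ∈ Finset.range N,
        (PhiSub.tau (PhiSub.powPhi ζ) P (ξ k) * Cδ k) ^ ζ) ^ (1 / ζ) * h ^ α) ∧
    -- `γ_N` is finite, and the bound for it
    IsLUB ((fun u => PhiSub.tau (PhiSub.powPhi ζ) P (Δ u)) '' Set.Icc 0 T) γN ∧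
    ENNReal.ofReal (γN ^ ζ) ≤
      (∑ k ∈ Finset.range N, ENNReal.ofReal (PhiSub.tau (PhiSub.powPhi ζ) P (ξ k) ^ ζ) *
        ⨆ u ∈ Set.Icc 0 T, ENNReal.ofReal (|a k u - â k u| ^ ζ)) +
      (∑' k, ENNReal.ofReal (PhiSub.tau (PhiSub.powPhi ζ) P (ξ (N + k)) ^ ζ) *
        ⨆ u ∈ Set.Icc 0 T, ENNReal.ofReal (|a (N + k) u| ^ ζ)) ∧
    -- reliability and accuracy, with `β = K (T/2)^α`
    (∀ K : ℝ, 0 ≤ K →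
      PhiSub.HasModulus (PhiSub.powPhi ζ) P (Set.Icc 0 T) Δ (fun h => K * h ^ α) →
      ∀ γ δ ν : ℝ, 0 < γ → γN ≤ γ → γ < δ →
        PhiSub.tailBound ζ α (K * (T / 2) ^ α) γ δ ≤ ν →
        PhiSub.Approximates P (Set.Icc 0 T) X (PhiSub.partialSum ξ â N) ν δ) := by
  have hΔ' : Δ = fun t ω => X t ω - PhiSub.partialSum ξ â N t ω := by
    ext t ω
    exact hΔ t ω
  have hsub : ∀ t ∈ Set.Icc 0 T, PhiSub.IsSub (PhiSub.powPhi ζ) P (Δ t) := fun t ht => by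
    rw [hΔ', PhiSub.isSub_iff hζ]
    exact ⟨(hX t ht).1.sub (PhiSub.measurable_partialSum (fun k => (hξ k).1) â N t), _,
      add_nonneg (Real.rpow_nonneg (PhiSub.tau_nonneg _ _ _) _) (Finset.sum_nonneg fun k _ =>
        Real.rpow_nonneg (mul_nonneg (PhiSub.tau_nonneg _ _ _) (abs_nonneg _)) _),
      PhiSub.expProxy_error hζ hX hξ hindep hser â N ht⟩
  have hmodΔ := PhiSub.hasModulus_error hζ hα hC hX hξ hindep hser hmod hCδ hδ
  rw [← hΔ'] at hmodΔ
  -- The set is nonempty and bounded, so the real `sSup` is a genuine supremum and not its default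
  -- value.
  have hlub : IsLUB ((fun u => PhiSub.tau (PhiSub.powPhi ζ) P (Δ u)) '' Set.Icc 0 T) γN := by
    rw [hγN]
    exact isLUB_csSup ⟨_, 0, ⟨le_rfl, hT.le⟩, rfl⟩ (PhiSub.bddAbove_tau hT hζ hsub hmodΔ)
  have hγ0 : 0 ≤ γN := (PhiSub.tau_nonneg _ _ _).trans (hlub.1 ⟨0, ⟨le_rfl, hT.le⟩, rfl⟩)
  refine ⟨hsub, hmodΔ, hlub, ?_, fun K hK hmodK γ δ ν hγ hγN' hγδ hν => ?_⟩
  · set r := (∑ k ∈ Finset.range N, ENNReal.ofReal (PhiSub.tau (PhiSub.powPhi ζ) P (ξ k) ^ ζ) *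
        ⨆ u ∈ Set.Icc 0 T, ENNReal.ofReal (|a k u - â k u| ^ ζ)) +
      (∑' k, ENNReal.ofReal (PhiSub.tau (PhiSub.powPhi ζ) P (ξ (N + k)) ^ ζ) *
        ⨆ u ∈ Set.Icc 0 T, ENNReal.ofReal (|a (N + k) u| ^ ζ)) with hr
    by_cases htop : r = ⊤
    · rw [htop]
      exact le_top
    have hle : γN ≤ r.toReal ^ (1 / ζ) := by
      refine hlub.2 ?_
      rintro _ ⟨t, ht, rfl⟩
      simp only [hΔ']
      exact PhiSub.tau_error_rpow_le hζ hX hξ hindep hser â N ht ENNReal.toReal_nonneg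
        (by rw [ENNReal.ofReal_toReal htop])
    rw [← ENNReal.ofReal_toReal htop]
    refine ENNReal.ofReal_le_ofReal ((Real.rpow_le_rpow hγ0 hle (by linarith)).trans
      (le_of_eq ?_))
    rw [← Real.rpow_mul ENNReal.toReal_nonneg, one_div_mul_cancel (by linarith), Real.rpow_one]
  · rw [hΔ'] at hmodK
    refine PhiSub.approximates_of_le_tailBound hT hζ hα hK hγ hγδ hsep (fun ω => ?_)
      (fun t ht => ?_) hmodK (fun t ht => ?_) hν
    · unfold PhiSub.partialSum
      refine continuousOn_finsetSum _ fun k hk => continuousOn_const.mul ?_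
      -- â_k = a_k - δ_k is a difference of Hölder functions, so the model has continuous paths.
      have h1 := PhiSub.continuousOn_of_abs_sub_le hα (ha k)
      have h2 := PhiSub.continuousOn_of_abs_sub_le (g := fun t => a k t - â k t) hα
        (hδ k (Finset.mem_range.1 hk))
      exact (h1.sub h2).congr fun t _ => by simp
    · simpa only [hΔ'] using hsub t ht
    · simpa only [hΔ'] using (hlub.1 ⟨t, ht, rfl⟩).trans hγN'
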